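/- Let $N\ge 1$, $0<s<2$ and $\Lambda>0$. There is a constant $\varepsilon_0\in(0,1)$, depending only on $N$, $s$ and $\Lambda$, with the following property. Let $K:(0,\infty)\times\mathbb R^N\times\mathbb R^N\to\mathbb R$ be measurable and such that, for all $t>0$ and $x\neq y$, $K(t,x,y)=K(t,y,x)$ and $$\mathbf 1_{\{|x-y|\le 3\}}\,\frac{1-s/2}{\Lambda}\,|x-y|^{-(N+s)}\le K(t,x,y)\le (1-s/2)\,\Lambda\,|x-y|^{-(N+s)}.$$ Let $w^0\in L^2(\mathbb R^N)$ and let $w$ be a weak solution on $(0,\infty)\times\mathbb R^N$ of $$w_t(t,x)=\int_{\mathbb R^N}[w(t,y)-w(t,x)]\,K(t,x,y)\,dy$$ with initial value $w^0$, that is, $w\in L^2(0,T;H^{s/2}(\mathbb R^N))$ for every $T>0$ and, for every $\eta\in C_c^\infty(\mathbb R^N)$ and almost every $t>0$, $$\int_{\mathbb R^N} w(t,x)\eta(x)\,dx-\int_{\mathbb R^N} w^0(x)\eta(x)\,dx+\frac12\int_0^t\!\int_{\mathbb R^N}\!\int_{\mathbb R^N}K(r,x,y)[w(r,x)-w(r,y)][\eta(x)-\eta(y)]\,dx\,dy\,dr=0.$$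 Then, for every $0<t_0<2$, $w$ is (essentially) bounded on $(t_0,\infty)\times\mathbb R^N$, and $$\operatorname*{ess\,sup}_{t>t_0,\;x\in\mathbb R^N}|w(t,x)|\le\frac{\|w^0\|_{L^2(\mathbb R^N)}}{2\sqrt{\varepsilon_0}\,(t_0/2)^{(N/s+1)/2}}.$$ -/

import Mathlib

open MeasureTheory Set
open scoped ENNReal ContDiff

noncomputable section

/-- Admissible kernels `K(t,x,y)`, `t > 0`, on `ℝ^N`: measurable, symmetric in `x, y`, and
`1_{|x-y| ≤ 3} (1-s/2) Λ⁻¹ |x-y|^{-(N+s)} ≤ K(t,x,y) ≤ (1-s/2) Λ |x-y|^{-(N+s)}` for `x ≠ y`. -/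
structure IsAdmissibleKernel (N : ℕ) (s Λ : ℝ)
    (K : ℝ → EuclideanSpace ℝ (Fin N) → EuclideanSpace ℝ (Fin N) → ℝ) : Prop where
  aemeasurable :
    AEMeasurable
      (fun p : ℝ × EuclideanSpace ℝ (Fin N) × EuclideanSpace ℝ (Fin N) => K p.1 p.2.1 p.2.2)
      (volume.restrict (Ioi (0 : ℝ) ×ˢ univ))
  symm : ∀ t > 0, ∀ x y, x ≠ y → K t x y = K t y x
  lower : ∀ t > 0, ∀ x y, x ≠ y →
    {z : EuclideanSpace ℝ (Fin N) | ‖z‖ ≤ 3}.indicator (fun _ => (1 : ℝ)) (x - y)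
        * ((1 - s / 2) / Λ) * ‖x - y‖ ^ (-((N : ℝ) + s)) ≤ K t x y
  upper : ∀ t > 0, ∀ x y, x ≠ y →
    K t x y ≤ (1 - s / 2) * Λ * ‖x - y‖ ^ (-((N : ℝ) + s))

/-- The form `∬ k(x,y) (u(x) - u(y)) (v(x) - v(y)) dx dy`. -/
def kernelForm {N : ℕ} (k : EuclideanSpace ℝ (Fin N) → EuclideanSpace ℝ (Fin N) → ℝ)
    (u v : EuclideanSpace ℝ (Fin N) → ℝ) : ℝ :=
  ∫ p : EuclideanSpace ℝ (Fin N) × EuclideanSpace ℝ (Fin N),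
    k p.1 p.2 * (u p.1 - u p.2) * (v p.1 - v p.2)

/-- The square of the Gagliardo seminorm of `H^{s/2}(ℝ^N)`. -/
def gagliardoSq {N : ℕ} (s : ℝ) (u : EuclideanSpace ℝ (Fin N) → ℝ) : ℝ≥0∞ :=
  ∫⁻ p : EuclideanSpace ℝ (Fin N) × EuclideanSpace ℝ (Fin N),
    ENNReal.ofReal ((u p.1 - u p.2) ^ 2 / ‖p.1 - p.2‖ ^ ((N : ℝ) + s))

/-- Weak (energy) solutions on `(0,∞) × ℝ^N`, with initial value `w₀`, of
`w_t(t,x) = ∫ (w(t,y) - w(t,x)) K(t,x,y) dy`.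
The function `w` is in `L²(0,T; H^{s/2})` for every `T`, and for every `η ∈ C_c^∞(ℝ^N)` the identity
`d/dt ∫ w η dx + (1/2) ∬ K (w(x) - w(y)) (η(x) - η(y)) dx dy = 0` holds, with `∫ w η dx` starting
from `∫ w₀ η dx`, in time-integrated form. The factor `1/2` comes from symmetrizing the
right-hand side of the equation. -/
structure IsWeakSolution {N : ℕ} (s : ℝ)
    (K : ℝ → EuclideanSpace ℝ (Fin N) → EuclideanSpace ℝ (Fin N) → ℝ)
    (w₀ : EuclideanSpace ℝ (Fin N) → ℝ) (w : ℝ → EuclideanSpace ℝ (Fin N) → ℝ) : Prop where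
  aemeasurable :
    AEMeasurable (fun p : ℝ × EuclideanSpace ℝ (Fin N) => w p.1 p.2)
      (volume.restrict (Ioi (0 : ℝ) ×ˢ univ))
  energy : ∀ T > 0,
    ∫⁻ t in Ioo 0 T, ((∫⁻ x, ENNReal.ofReal (w t x ^ 2)) + gagliardoSq s (w t)) < ⊤
  weak : ∀ η : EuclideanSpace ℝ (Fin N) → ℝ, ContDiff ℝ ∞ η → HasCompactSupport η →
    ∀ᵐ t ∂(volume.restrict (Ioi (0 : ℝ))),
      (∫ x, w t x * η x) - (∫ x, w₀ x * η x)
        + ∫ r in Ioo 0 t, (1 / 2) * kernelForm (K r) (w r) η = 0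

end

/-! The proof is De Giorgi's iteration from L² to L^∞ for a nonlocal parabolic equation. Let A(t,c)
= ∫ (w(t) - c)₊² dx, and let E(t,c) be the form of K evaluated at w(t) and (w(t) - c)₊. Testing the
equation with (w - c)₊ gives, for almost every t, A(t,c) + ∫₀ᵗ E(r,c) dr = A(0,c)
(`ae_integral_sq_posPart`). Truncation is monotone, so E ≥ 0 and A decreases in time.

Averaging v(y)² ≤ (v(x) - v(y))² + 2 v(x) v(y) over |x - y| ≤ ρ ≤ 3, where K is bounded below, and
comparing two levels c' < c by Chebyshev's inequality gives A(r,c) ≤ a ρ^s E(r,c) + b ρ^(-N)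
(A(r,c')/(c - c'))² (`levelEnergy_le`). Integration over t₁ < r < t₂ replaces E by A(t₁,c')/(t₂ -
t₁) (`levelEnergy_step`). When the levels increase to M, the times increase to t₀ and ρ^s shrinks
like 2^(-k), all geometrically, the energies decay like q^k as soon as M² ≥ Q t₀^(-N/s) ‖w⁰‖². In
the limit w ≤ M after t₀ (`exists_ae_le`). The equation is linear, so -w obeys the same bound.

The delicate point is the energy identity, because (w - c)₊ is not an admissible test function. A
mollifier centred at x is admissible, and it shows that t ↦ `mol n (w t) x` agrees almost everywhere
with an absolutely continuous function. The scalar chain rule, integration in x and Fubini then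
produce the form tested with the mollification of (`mol n (w t)` - c)₊. This converges to (w - c)₊
in the Gagliardo seminorm, since |x - y|^(-(N+s)) dx dy is invariant under diagonal translations and
averaging does not increase L² norms. The upper bound on K serves only integrability and does not
enter Q. -/

/-! ### Convergence in L², Minkowski's inequality, and the chain rule for squared positive parts. -/

section General

open Filter Topology Measure

variable {α β : Type*} [MeasurableSpace α] [MeasurableSpace β]

/-- A generalized dominated convergence theorem with varying dominating functions. -/
theorem tendsto_lintegral_zero_of_dominated {μ : Measure α} {c g : ℕ → α → ℝ≥0∞} {G : α → ℝ≥0∞}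
    (hc : ∀ n, AEMeasurable (c n) μ) (hg : ∀ n, AEMeasurable (g n) μ)
    (hle : ∀ n, ∀ᵐ a ∂μ, c n a ≤ g n a)
    (hc0 : ∀ᵐ a ∂μ, Tendsto (fun n => c n a) atTop (𝓝 0))
    (hgG : ∀ᵐ a ∂μ, Tendsto (fun n => g n a) atTop (𝓝 (G a)))
    (hG : ∫⁻ a, G a ∂μ ≠ ⊤) (hint : ∀ n, ∫⁻ a, g n a ∂μ ≤ ∫⁻ a, G a ∂μ) :
    Tendsto (fun n => ∫⁻ a, c n a ∂μ) atTop (𝓝 0) := by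
  set S := ∫⁻ a, G a ∂μ with hS
  have hsplit : ∀ n, ∫⁻ a, (g n a - c n a) ∂μ + ∫⁻ a, c n a ∂μ ≤ S := by
    intro n
    rw [← lintegral_add_right' _ (hc n)]
    refine le_trans (le_of_eq ?_) (hint n)
    refine lintegral_congr_ae ?_
    filter_upwards [hle n] with a ha using tsub_add_cancel_of_le ha
  -- Fatou applied to `g n - c n` recovers all of `S`, which by `hsplit` leaves no room for the
  -- integrals of `c n`.
  have hfatou : S ≤ liminf (fun n => ∫⁻ a, (g n a - c n a) ∂μ) atTop := by
    refine le_trans (le_of_eq ?_) (lintegral_liminf_le' fun n => (hg n).sub (hc n))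
    refine lintegral_congr_ae ?_
    filter_upwards [hc0, hgG] with a h0 h1
    have := ENNReal.Tendsto.sub h1 h0 (Or.inr ENNReal.zero_ne_top)
    rw [tsub_zero] at this
    exact this.liminf_eq.symm
  rw [ENNReal.tendsto_nhds_zero]
  intro ε hε
  rcases eq_or_ne S 0 with h0 | h0
  · filter_upwards with n
    have := hsplit n
    rw [h0] at this
    exact (le_add_self.trans this).trans zero_le
  rcases eq_or_ne ε ⊤ with rfl | hεt
  · simp
  have hlt : S - ε < liminf (fun n => ∫⁻ a, (g n a - c n a) ∂μ) atTop :=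
    (ENNReal.sub_lt_self hG h0 hε.ne').trans_le hfatou
  filter_upwards [eventually_lt_of_lt_liminf hlt] with n hn
  have h1 := hsplit n
  by_contra! hcon
  have h2 : S ≤ (S - ε) + ε := le_tsub_add
  have h3 : (S - ε) + ε < ∫⁻ a, (g n a - c n a) ∂μ + ∫⁻ a, c n a ∂μ := ENNReal.add_lt_add hn hcon
  exact absurd (h2.trans_lt h3) (not_lt.2 h1)

theorem eLpNorm_two_sq (f : α → ℝ) (μ : Measure α) :
    eLpNorm f 2 μ ^ 2 = ∫⁻ x, ‖f x‖ₑ ^ 2 ∂μ := by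
  have := eLpNorm_nnreal_pow_eq_lintegral (f := f) (μ := μ) (p := 2) (by norm_num)
  simpa using this

theorem eLpNorm_two_le_iff {f : α → ℝ} {μ : Measure α} {B : ℝ≥0∞} :
    eLpNorm f 2 μ ≤ B ↔ ∫⁻ x, ‖f x‖ₑ ^ 2 ∂μ ≤ B ^ 2 := by
  rw [← eLpNorm_two_sq]
  exact ⟨fun h => pow_le_pow_left' h 2, fun h => not_lt.1 fun h1 =>
    absurd h (not_le.2 (ENNReal.pow_lt_pow_left two_ne_zero h1))⟩

/-- Strong `L²` convergence of `a n`, when `|a n| ≤ |b n|`, `b n → b` almost everywhere and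
`‖b n‖ ≤ ‖b‖`. -/
theorem tendsto_eLpNorm_sub_of_abs_le {μ : Measure α} {a b : ℕ → α → ℝ} {a' b' : α → ℝ}
    (ha : ∀ n, AEStronglyMeasurable (a n) μ) (ha' : AEStronglyMeasurable a' μ)
    (hb : ∀ n, AEStronglyMeasurable (b n) μ) (hb' : MemLp b' 2 μ)
    (hnorm : ∀ n, eLpNorm (b n) 2 μ ≤ eLpNorm b' 2 μ)
    (hab : ∀ n, ∀ᵐ x ∂μ, |a n x| ≤ |b n x|)
    (hlima : ∀ᵐ x ∂μ, Tendsto (fun n => a n x) atTop (𝓝 (a' x)))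
    (hlimb : ∀ᵐ x ∂μ, Tendsto (fun n => b n x) atTop (𝓝 (b' x))) :
    Tendsto (fun n => eLpNorm (a n - a') 2 μ) atTop (𝓝 0) := by
  have hab' : ∀ᵐ x ∂μ, |a' x| ≤ |b' x| := by
    filter_upwards [ae_all_iff.2 hab, hlima, hlimb] with x h1 h2 h3
    exact le_of_tendsto_of_tendsto' h2.abs h3.abs h1
  have hfin : ∫⁻ x, ‖b' x‖ₑ ^ 2 ∂μ ≠ ⊤ := by
    rw [← eLpNorm_two_sq]; exact ENNReal.pow_ne_top hb'.2.ne
  have hB := hb'.1.enorm.pow_const 2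
  -- The bound |a - a'|² ≤ 2 b² + 2 b'² varies with n, but by `hnorm` its integral never exceeds
  -- that of its limit.
  have key : Tendsto (fun n => ∫⁻ x, ‖a n x - a' x‖ₑ ^ 2 ∂μ) atTop (𝓝 0) := by
    refine tendsto_lintegral_zero_of_dominated
      (g := fun n x => 2 * ‖b n x‖ₑ ^ 2 + 2 * ‖b' x‖ₑ ^ 2)
      (G := fun x => 2 * ‖b' x‖ₑ ^ 2 + 2 * ‖b' x‖ₑ ^ 2) ?_ ?_ ?_ ?_ ?_ ?_ ?_
    · exact fun n => ((ha n).sub ha').enorm.pow_const 2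
    · exact fun n => (((hb n).enorm.pow_const 2).const_mul 2).add (hB.const_mul 2)
    · intro n
      filter_upwards [hab n, hab'] with x h1 h2
      have e : ∀ y : ℝ, ‖y‖ₑ ^ 2 = ENNReal.ofReal (y ^ 2) := fun y => by
        rw [Real.enorm_eq_ofReal_abs, ← ENNReal.ofReal_pow (abs_nonneg _), sq_abs]
      have e2 : (2 : ℝ≥0∞) = ENNReal.ofReal 2 := by simp
      rw [e, e, e, e2, ← ENNReal.ofReal_mul (by norm_num), ← ENNReal.ofReal_mul (by norm_num),
        ← ENNReal.ofReal_add (by positivity) (by positivity)]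
      refine ENNReal.ofReal_le_ofReal ?_
      have h3 := sq_le_sq.2 h1
      have h4 := sq_le_sq.2 h2
      nlinarith [sq_nonneg (a n x + a' x)]
    · filter_upwards [hlima] with x hx
      have h1 : Tendsto (fun n => a n x - a' x) atTop (𝓝 0) := by
        simpa using hx.sub_const (a' x)
      have h2 := (ENNReal.continuous_pow 2).continuousAt.tendsto.comp h1.enorm
      simpa [Function.comp_def] using h2
    · filter_upwards [hlimb] with x hx
      have h2 := (ENNReal.continuous_pow 2).continuousAt.tendsto.comp hx.enorm
      exact (ENNReal.Tendsto.const_mul h2 (Or.inr (by simp))).add_const _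
    · rw [lintegral_add_left' (hB.const_mul 2), lintegral_const_mul'' _ hB]
      exact ENNReal.add_ne_top.2 ⟨ENNReal.mul_ne_top (by simp) hfin,
        ENNReal.mul_ne_top (by simp) hfin⟩
    · intro n
      have hBn := (hb n).enorm.pow_const 2
      rw [lintegral_add_left' (hB.const_mul 2), lintegral_add_left' (hBn.const_mul 2),
        lintegral_const_mul'' _ hB, lintegral_const_mul'' _ hBn]
      refine add_le_add (mul_le_mul_right ?_ 2) le_rfl
      rw [← eLpNorm_two_sq, ← eLpNorm_two_sq]
      exact pow_le_pow_left' (hnorm n) 2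
  have h3 := (ENNReal.continuous_rpow_const (y := 1/2)).continuousAt.tendsto.comp key
  rw [ENNReal.zero_rpow_of_pos (by norm_num)] at h3
  refine h3.congr fun n => ?_
  have := eLpNorm_two_sq (a n - a') μ
  simp only [Function.comp, Pi.sub_apply] at this ⊢
  rw [← this, ← ENNReal.rpow_natCast, ← ENNReal.rpow_mul]
  norm_num

/-- Minkowski's inequality for averages of functions in `L²`. -/
theorem eLpNorm_integral_le {P : Measure β} [IsProbabilityMeasure P] {μ : Measure α} [SFinite μ]
    {F : β → α → ℝ} (hF : Measurable (Function.uncurry F)) {B : ℝ≥0∞}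
    (hB : ∀ z, eLpNorm (F z) 2 μ ≤ B) :
    eLpNorm (fun a => ∫ z, F z a ∂P) 2 μ ≤ B := by
  rw [eLpNorm_two_le_iff]
  have hF2 : Measurable (fun q : α × β => ‖F q.2 q.1‖ₑ ^ 2) :=
    (hF.comp measurable_swap).enorm.pow_const 2
  calc ∫⁻ a, ‖∫ z, F z a ∂P‖ₑ ^ 2 ∂μ
      ≤ ∫⁻ a, ∫⁻ z, ‖F z a‖ₑ ^ 2 ∂P ∂μ := by
        refine lintegral_mono fun a => ?_
        have hFa : AEStronglyMeasurable (fun z => F z a) P :=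
          (hF.comp (measurable_id.prodMk measurable_const)).aestronglyMeasurable
        have h1 := eLpNorm_le_eLpNorm_of_exponent_le (p := 1) (q := 2) (by norm_num) hFa
        rw [← eLpNorm_two_sq (fun z => F z a)]
        refine pow_le_pow_left' (le_trans ?_ h1) 2
        rw [eLpNorm_one_eq_lintegral_enorm]
        exact enorm_integral_le_lintegral_enorm _
    _ = ∫⁻ z, ∫⁻ a, ‖F z a‖ₑ ^ 2 ∂μ ∂P := lintegral_lintegral_swap hF2.aemeasurable
    _ ≤ ∫⁻ _z, B ^ 2 ∂P := lintegral_mono fun z => eLpNorm_two_le_iff.1 (hB z)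
    _ = B ^ 2 := by simp

/-- The chain rule for the square of the positive part of an absolutely continuous function. -/
theorem sq_posPart_sub_eq_integral {f : ℝ → ℝ} {T : ℝ}
    (hf : IntervalIntegrable f volume 0 T) (a c : ℝ) :
    max (a - (∫ r in (0:ℝ)..T, f r) - c) 0 ^ 2 - max (a - c) 0 ^ 2
      = -2 * ∫ t in (0:ℝ)..T, max (a - (∫ r in (0:ℝ)..t, f r) - c) 0 * f t := by
  set W : ℝ → ℝ := fun t => a - ∫ r in (0:ℝ)..t, f r with hW
  set φ : ℝ → ℝ := fun t => max (W t - c) 0 with hφ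
  have hint := hf.absolutelyContinuousOnInterval_intervalIntegral (c := 0) (by simp)
  have hφac : AbsolutelyContinuousOnInterval φ 0 T := by
    rw [absolutelyContinuousOnInterval_iff] at hint ⊢
    intro ε hε
    obtain ⟨δ, hδ, h⟩ := hint ε hε
    refine ⟨δ, hδ, fun E hE hlt => lt_of_le_of_lt (Finset.sum_le_sum fun i _ => ?_) (h E hE hlt)⟩
    simp only [Real.dist_eq, hφ, hW]
    refine (abs_max_sub_max_le_abs _ _ _).trans (le_of_eq ?_)
    rw [← abs_neg]
    congr 1
    ring
  have hprod := hφac.integral_deriv_mul_eq_sub hφac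
  have hφ0 : φ 0 = max (a - c) 0 := by simp [hφ, hW]
  rw [show max (a - (∫ r in (0:ℝ)..T, f r) - c) 0 ^ 2 - max (a - c) 0 ^ 2
    = φ T * φ T - φ 0 * φ 0 by rw [hφ0]; simp only [hφ, hW]; ring, ← hprod,
    ← intervalIntegral.integral_const_mul]
  refine intervalIntegral.integral_congr_ae ?_
  filter_upwards [hf.ae_hasDerivAt_integral] with x hx hxT
  have hder := (hx (uIoc_subset_uIcc hxT) 0 (by simp)).const_sub a
  change _ = -2 * (φ x * f x)
  -- At or below the level the factor `φ x` vanishes, so it is harmless that φ may fail to be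
  -- differentiable at the kink.
  rcases le_or_gt (W x - c) 0 with h | h
  · have : φ x = 0 := max_eq_right h
    rw [this]; ring
  · have hW' : HasDerivAt W (-f x) x := hder
    have hev : ∀ᶠ y in 𝓝 x, 0 < W y - c :=
      (hW'.continuousAt.sub_const c).eventually (lt_mem_nhds h)
    have : HasDerivAt φ (-f x) x := by
      refine (hW'.sub_const c).congr_of_eventuallyEq ?_
      filter_upwards [hev] with y hy using max_eq_left hy.le
    rw [this.deriv]; ring

end General

/-! ### Mollification as averaging over translates, in L² and in the Gagliardo seminorm. -/

section Mollification

open Filter Topology Measure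

abbrev Eucl (N : ℕ) : Type := EuclideanSpace ℝ (Fin N)

variable {N : ℕ} {s : ℝ}

/-- The measure `|x - y|^{-(N+s)} dx dy`, for which the Gagliardo seminorm of `u` is the `L²` norm
of `u(x) - u(y)`. -/
noncomputable def gagliardoMeasure (N : ℕ) (s : ℝ) : Measure (Eucl N × Eucl N) :=
  volume.withDensity fun p => ENNReal.ofReal (‖p.1 - p.2‖ ^ (-((N : ℝ) + s)))

/-- The difference `u(x) - u(y)`. -/
def diff (u : Eucl N → ℝ) (p : Eucl N × Eucl N) : ℝ := u p.1 - u p.2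

theorem measurable_diff {u : Eucl N → ℝ} (hu : Measurable u) : Measurable (diff u) :=
  (hu.comp measurable_fst).sub (hu.comp measurable_snd)

theorem measurable_gagliardoDensity (N : ℕ) (s : ℝ) :
    Measurable fun p : Eucl N × Eucl N => ‖p.1 - p.2‖ ^ (-((N : ℝ) + s)) := by
  fun_prop

instance : SFinite (gagliardoMeasure N s) := by
  unfold gagliardoMeasure; infer_instance

theorem gagliardoMeasure_absolutelyContinuous : gagliardoMeasure N s ≪ volume :=
  withDensity_absolutelyContinuous _ _

/-- The density depends only on the difference of the two points. This invariance is what makes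
mollification a contraction of the Gagliardo seminorm. -/
theorem measurePreserving_gagliardoMeasure (z : Eucl N) :
    MeasurePreserving (fun p : Eucl N × Eucl N => (p.1 - z, p.2 - z))
      (gagliardoMeasure N s) (gagliardoMeasure N s) := by
  have hvol : MeasurePreserving (fun p : Eucl N × Eucl N => (p.1 - z, p.2 - z)) volume volume :=
    (measurePreserving_sub_right (volume : Measure (Eucl N)) z).prod
      (measurePreserving_sub_right (volume : Measure (Eucl N)) z)
  refine ⟨hvol.measurable, Measure.ext fun A hA => ?_⟩
  rw [map_apply hvol.measurable hA, gagliardoMeasure, withDensity_apply _ (hvol.measurable hA),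
    withDensity_apply _ hA,
    ← hvol.setLIntegral_comp_preimage hA (measurable_gagliardoDensity N s).ennreal_ofReal]
  simp

/-- The ratio of the two radii stays equal to 2; the almost everywhere convergence in
`ae_tendsto_mol` needs it bounded. -/
noncomputable def mollBump (N n : ℕ) : ContDiffBump (0 : Eucl N) :=
  ⟨1 / (n + 1), 2 / (n + 1), by positivity, by gcongr; norm_num⟩

/-- A sequence of mollifiers. -/
noncomputable def moll (N n : ℕ) : Eucl N → ℝ := (mollBump N n).normed volume

/-- As a probability measure it turns mollification into an expectation, to which
`eLpNorm_integral_le` applies. -/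
noncomputable def mollMeasure (N n : ℕ) : Measure (Eucl N) :=
  volume.withDensity fun z => ENNReal.ofReal (moll N n z)

/-- The mollification of `u`. -/
noncomputable def mol (n : ℕ) (u : Eucl N → ℝ) (x : Eucl N) : ℝ := ∫ z, u (x - z) ∂mollMeasure N n

theorem moll_def (N n : ℕ) : moll N n = (mollBump N n).normed volume := rfl

theorem moll_nonneg (n : ℕ) (z : Eucl N) : 0 ≤ moll N n z := (mollBump N n).nonneg_normed z

theorem moll_neg (n : ℕ) (z : Eucl N) : moll N n (-z) = moll N n z :=
  (mollBump N n).normed_neg z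

theorem contDiff_moll (n : ℕ) : ContDiff ℝ ∞ (moll N n) := (mollBump N n).contDiff_normed

theorem continuous_moll (n : ℕ) : Continuous (moll N n) := (contDiff_moll n).continuous

theorem hasCompactSupport_moll (n : ℕ) : HasCompactSupport (moll N n) :=
  (mollBump N n).hasCompactSupport_normed

instance (n : ℕ) : IsProbabilityMeasure (mollMeasure N n) := by
  constructor
  rw [mollMeasure, withDensity_apply _ MeasurableSet.univ, setLIntegral_univ,
    ← ofReal_integral_eq_lintegral_ofReal]
  · rw [moll, (mollBump N n).integral_normed]; simp
  · exact (mollBump N n).integrable_normed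
  · exact Eventually.of_forall (moll_nonneg n)

theorem integral_mollMeasure (n : ℕ) (f : Eucl N → ℝ) :
    ∫ z, f z ∂mollMeasure N n = ∫ z, moll N n z * f z := by
  rw [mollMeasure, integral_withDensity_eq_integral_toReal_smul
    (continuous_moll n).measurable.ennreal_ofReal (by simp)]
  simp [ENNReal.toReal_ofReal (moll_nonneg n _)]

theorem mol_eq (n : ℕ) (u : Eucl N → ℝ) (x : Eucl N) :
    mol n u x = ∫ y, u y * moll N n (x - y) := by
  rw [mol, integral_mollMeasure, ← integral_sub_left_eq_self _ volume x]
  simp [mul_comm]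

theorem memLp_moll (n : ℕ) : MemLp (moll N n) 2 volume :=
  (continuous_moll n).memLp_of_hasCompactSupport (hasCompactSupport_moll n)

theorem memLp_comp_sub_left {u : Eucl N → ℝ} (hu : MemLp u 2 volume) (x : Eucl N) :
    MemLp (fun z => u (x - z)) 2 volume :=
  hu.comp_measurePreserving (measurePreserving_sub_left volume x)

theorem integrable_mollMeasure {u : Eucl N → ℝ} (n : ℕ) (hu : MemLp u 2 volume) (x : Eucl N) :
    Integrable (fun z => u (x - z)) (mollMeasure N n) := by
  rw [mollMeasure, integrable_withDensity_iff_integrable_smul'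
    (continuous_moll n).measurable.ennreal_ofReal (by simp)]
  refine ((memLp_moll n).integrable_mul (memLp_comp_sub_left hu x)).congr ?_
  filter_upwards with z
  simp [ENNReal.toReal_ofReal (moll_nonneg n _)]

theorem measurable_mol_uncurry {γ : Type*} [MeasurableSpace γ] {w : γ → Eucl N → ℝ}
    (hw : Measurable (Function.uncurry w)) (n : ℕ) :
    Measurable (fun q : γ × Eucl N => mol n (w q.1) q.2) := by
  have h : StronglyMeasurable (fun r : (γ × Eucl N) × Eucl N => w r.1.1 (r.1.2 - r.2)) :=
    (hw.comp (show Measurable fun r : (γ × Eucl N) × Eucl N => (r.1.1, r.1.2 - r.2) by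
      fun_prop)).stronglyMeasurable
  exact h.integral_prod_right.measurable

theorem measurable_mol {u : Eucl N → ℝ} (hu : Measurable u) (n : ℕ) : Measurable (mol n u) := by
  have h : StronglyMeasurable (fun r : Eucl N × Eucl N => u (r.1 - r.2)) :=
    (hu.comp (show Measurable fun r : Eucl N × Eucl N => r.1 - r.2 by fun_prop)).stronglyMeasurable
  exact h.integral_prod_right.measurable

theorem diff_mol {u : Eucl N → ℝ} (hu : MemLp u 2 volume) (n : ℕ) (p : Eucl N × Eucl N) :
    diff (mol n u) p = ∫ z, diff u (p.1 - z, p.2 - z) ∂mollMeasure N n := by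
  have := integral_sub (integrable_mollMeasure n hu p.1) (integrable_mollMeasure n hu p.2)
  exact this.symm

theorem eLpNorm_average_le {h : Eucl N × Eucl N → ℝ} (hh : Measurable h) (n : ℕ) :
    eLpNorm (fun p : Eucl N × Eucl N => ∫ z, h (p.1 - z, p.2 - z) ∂mollMeasure N n) 2
      (gagliardoMeasure N s) ≤ eLpNorm h 2 (gagliardoMeasure N s) := by
  have hm : Measurable fun q : Eucl N × Eucl N × Eucl N => h (q.2.1 - q.1, q.2.2 - q.1) :=
    hh.comp (by fun_prop)
  refine eLpNorm_integral_le (F := fun z (p : Eucl N × Eucl N) => h (p.1 - z, p.2 - z)) hm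
    fun z => ?_
  exact (eLpNorm_comp_measurePreserving hh.aestronglyMeasurable
    (measurePreserving_gagliardoMeasure z)).le

theorem eLpNorm_mol_le {u : Eucl N → ℝ} (hu : Measurable u) (n : ℕ) :
    eLpNorm (mol n u) 2 volume ≤ eLpNorm u 2 volume := by
  refine eLpNorm_integral_le (F := fun z x => u (x - z))
    (hu.comp (show Measurable fun q : Eucl N × Eucl N => q.2 - q.1 by fun_prop)) fun z => ?_
  exact (eLpNorm_comp_measurePreserving hu.aestronglyMeasurable
    (measurePreserving_sub_right volume z)).le

theorem eLpNorm_diff_mol_le {u : Eucl N → ℝ} (hu : Measurable u) (hu2 : MemLp u 2 volume) (n : ℕ) :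
    eLpNorm (diff (mol n u)) 2 (gagliardoMeasure N s)
      ≤ eLpNorm (diff u) 2 (gagliardoMeasure N s) := by
  rw [show diff (mol n u) = fun p => ∫ z, diff u (p.1 - z, p.2 - z) ∂mollMeasure N n from
    funext (diff_mol hu2 n)]
  exact eLpNorm_average_le (measurable_diff hu) n

theorem memLp_mol {u : Eucl N → ℝ} (hu : Measurable u) (hu2 : MemLp u 2 volume) (n : ℕ) :
    MemLp (mol n u) 2 volume :=
  ⟨(measurable_mol hu n).aestronglyMeasurable, (eLpNorm_mol_le hu n).trans_lt hu2.2⟩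

theorem memLp_diff_mol {u : Eucl N → ℝ} (hu : Measurable u) (hu2 : MemLp u 2 volume)
    (hd : MemLp (diff u) 2 (gagliardoMeasure N s)) (n : ℕ) :
    MemLp (diff (mol n u)) 2 (gagliardoMeasure N s) :=
  ⟨(measurable_diff (measurable_mol hu n)).aestronglyMeasurable,
    (eLpNorm_diff_mol_le hu hu2 n).trans_lt hd.2⟩

theorem ae_tendsto_mol {u : Eucl N → ℝ} (hu : MemLp u 2 volume) :
    ∀ᵐ x, Tendsto (fun n => mol n u x) atTop (𝓝 (u x)) := by
  have h1 : Tendsto (fun n => (mollBump N n).rOut) atTop (𝓝 0) := by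
    have := (tendsto_one_div_add_atTop_nhds_zero_nat (𝕜 := ℝ)).const_mul 2
    simpa [mollBump, div_eq_mul_inv] using this
  filter_upwards [ContDiffBump.ae_convolution_tendsto_right_of_locallyIntegrable (μ := volume) h1
    (K := 2) (Eventually.of_forall fun n => by simp [mollBump]; rw [div_eq_mul_inv])
    (hu.locallyIntegrable (by norm_num))] with x hx
  refine hx.congr fun n => ?_
  rw [mol, integral_mollMeasure]
  rfl

theorem ae_gagliardoMeasure {P : Eucl N → Prop} (h : ∀ᵐ x, P x) :
    ∀ᵐ p ∂gagliardoMeasure N s, P p.1 ∧ P p.2 := by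
  refine gagliardoMeasure_absolutelyContinuous.ae_le ?_
  exact (Measure.quasiMeasurePreserving_fst.ae h).and (Measure.quasiMeasurePreserving_snd.ae h)

theorem tendsto_eLpNorm_mol_sub {u : Eucl N → ℝ} (hu : Measurable u) (hu2 : MemLp u 2 volume) :
    Tendsto (fun n => eLpNorm (mol n u - u) 2 volume) atTop (𝓝 0) :=
  tendsto_eLpNorm_sub_of_abs_le (fun n => (measurable_mol hu n).aestronglyMeasurable) hu2.1
    (fun n => (measurable_mol hu n).aestronglyMeasurable) hu2 (fun n => eLpNorm_mol_le hu n)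
    (fun _ => Eventually.of_forall fun _ => le_rfl) (ae_tendsto_mol hu2) (ae_tendsto_mol hu2)

/-- Mollifying, applying a contraction `φ` and mollifying again approximates `φ ∘ u` in the
Gagliardo seminorm. -/
theorem tendsto_eLpNorm_diff_mol_comp_mol {u : Eucl N → ℝ} (hu : Measurable u)
    (hu2 : MemLp u 2 volume) (hd : MemLp (diff u) 2 (gagliardoMeasure N s)) {φ : ℝ → ℝ}
    (hφ : ∀ a b, |φ a - φ b| ≤ |a - b|) (hφ0 : φ 0 = 0) :
    Tendsto (fun n => eLpNorm (diff (mol n (φ ∘ mol n u)) - diff (φ ∘ u)) 2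
      (gagliardoMeasure N s)) atTop (𝓝 0) := by
  have hφc : Continuous φ := (LipschitzWith.of_dist_le_mul (K := 1) fun a b => by
    simpa [Real.dist_eq] using hφ a b).continuous
  have hφabs : ∀ a, |φ a| ≤ |a| := fun a => by simpa [hφ0] using hφ a 0
  have hcomp2 : ∀ {v : Eucl N → ℝ}, Measurable v → MemLp v 2 volume → MemLp (φ ∘ v) 2 volume :=
    fun hv hv2 => hv2.mono (hφc.measurable.comp hv).aestronglyMeasurable
      (Eventually.of_forall fun x => hφabs _)
  have hcompd : ∀ {v : Eucl N → ℝ}, Measurable v → MemLp (diff v) 2 (gagliardoMeasure N s) →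
      MemLp (diff (φ ∘ v)) 2 (gagliardoMeasure N s) :=
    fun hv hv2 => hv2.mono (measurable_diff (hφc.measurable.comp hv)).aestronglyMeasurable
      (Eventually.of_forall fun x => hφ _ _)
  have hm : ∀ n, Measurable (φ ∘ mol n u) := fun n => hφc.measurable.comp (measurable_mol hu n)
  have hv : Measurable (φ ∘ u) := hφc.measurable.comp hu
  have hae := ae_gagliardoMeasure (s := s) (ae_tendsto_mol hu2)
  -- Composition with a contraction need not be Lipschitz for the seminorm. Convergence comes
  -- instead from pointwise domination by `diff (mol n u)`, whose norms do not exceed that of its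
  -- limit `diff u`.
  have h1 : Tendsto (fun n => eLpNorm (diff (φ ∘ mol n u) - diff (φ ∘ u)) 2
      (gagliardoMeasure N s)) atTop (𝓝 0) := by
    refine tendsto_eLpNorm_sub_of_abs_le (b := fun n => diff (mol n u)) (b' := diff u)
      (fun n => (measurable_diff (hm n)).aestronglyMeasurable)
      (measurable_diff hv).aestronglyMeasurable
      (fun n => (measurable_diff (measurable_mol hu n)).aestronglyMeasurable) hd
      (fun n => eLpNorm_diff_mol_le hu hu2 n)
      (fun n => Eventually.of_forall fun p => hφ _ _) ?_ ?_
    · filter_upwards [hae] with p hp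
      exact ((hφc.tendsto _).comp hp.1).sub ((hφc.tendsto _).comp hp.2)
    · filter_upwards [hae] with p hp using hp.1.sub hp.2
  have h2 : Tendsto (fun n => eLpNorm (diff (mol n (φ ∘ u)) - diff (φ ∘ u)) 2
      (gagliardoMeasure N s)) atTop (𝓝 0) := by
    have hvm := fun n => (measurable_diff (measurable_mol hv n)).aestronglyMeasurable
      (μ := gagliardoMeasure N s)
    have hae' : ∀ᵐ p ∂gagliardoMeasure N s,
        Tendsto (fun n => diff (mol n (φ ∘ u)) p) atTop (𝓝 (diff (φ ∘ u) p)) := by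
      filter_upwards [ae_gagliardoMeasure (s := s) (ae_tendsto_mol (hcomp2 hu hu2))] with p hp
      exact hp.1.sub hp.2
    exact tendsto_eLpNorm_sub_of_abs_le hvm (measurable_diff hv).aestronglyMeasurable hvm
      (hcompd hu hd) (fun n => eLpNorm_diff_mol_le hv (hcomp2 hu hu2) n)
      (fun n => Eventually.of_forall fun p => le_rfl) hae' hae'
  have h3 := h1.add h2
  rw [add_zero] at h3
  refine tendsto_of_tendsto_of_tendsto_of_le_of_le tendsto_const_nhds h3 (fun _ => zero_le)
    fun n => ?_
  have hmn2 := hcomp2 (measurable_mol hu n) (memLp_mol hu hu2 n)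
  -- The first summand is an average of translates of the quantity in `h1`, hence no larger in norm;
  -- the second is the quantity in `h2`.
  have e : diff (mol n (φ ∘ mol n u)) - diff (φ ∘ u)
      = (fun p => ∫ z, (diff (φ ∘ mol n u) - diff (φ ∘ u)) (p.1 - z, p.2 - z) ∂mollMeasure N n)
        + (diff (mol n (φ ∘ u)) - diff (φ ∘ u)) := by
    funext p
    have i1 : Integrable (fun z => diff (φ ∘ mol n u) (p.1 - z, p.2 - z)) (mollMeasure N n) :=
      (integrable_mollMeasure n hmn2 p.1).sub (integrable_mollMeasure n hmn2 p.2)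
    have i2 : Integrable (fun z => diff (φ ∘ u) (p.1 - z, p.2 - z)) (mollMeasure N n) :=
      (integrable_mollMeasure n (hcomp2 hu hu2) p.1).sub
        (integrable_mollMeasure n (hcomp2 hu hu2) p.2)
    have := integral_sub i1 i2
    simp only [Pi.add_apply, Pi.sub_apply] at this ⊢
    rw [this, ← diff_mol hmn2, ← diff_mol (hcomp2 hu hu2)]
    ring
  rw [e]
  refine (eLpNorm_add_le ?_ ?_ (by norm_num)).trans (add_le_add_left ?_ _)
  · have : Measurable (Function.uncurry fun (p : Eucl N × Eucl N) z =>
        (diff (φ ∘ mol n u) - diff (φ ∘ u)) (p.1 - z, p.2 - z)) :=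
      ((measurable_diff (hm n)).sub (measurable_diff hv)).comp
        (show Measurable fun q : (Eucl N × Eucl N) × Eucl N => (q.1.1 - q.2, q.1.2 - q.2) by
          fun_prop)
    exact this.stronglyMeasurable.integral_prod_right.aestronglyMeasurable
  · exact ((measurable_diff (measurable_mol hv n)).sub (measurable_diff hv)).aestronglyMeasurable
  · exact eLpNorm_average_le ((measurable_diff (hm n)).sub (measurable_diff hv)) n

attribute [irreducible] moll mollMeasure

end Mollification

/-! ### Lévy integrability and Gagliardo bounds for translated mollifiers. -/

section KernelBounds

open Filter Topology Measure

variable {N : ℕ} {s : ℝ}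

/-- The truncated Lévy density `min(1, |h|²) |h|^{-(N+s)}`. -/
noncomputable def levyDensity (N : ℕ) (s : ℝ) (h : Eucl N) : ℝ :=
  min 1 (‖h‖ ^ 2) * ‖h‖ ^ (-((N : ℝ) + s))

theorem levyDensity_nonneg (h : Eucl N) : 0 ≤ levyDensity N s h := by
  unfold levyDensity; positivity

@[fun_prop]
theorem measurable_levyDensity : Measurable (levyDensity N s) := by
  unfold levyDensity; fun_prop

/-- In polar coordinates the integrand is r^(1-s) near the origin, integrable because s < 2, and
r^(-1-s) at infinity, integrable because s > 0. -/
theorem integrable_levyDensity (hN : 1 ≤ N) (hs0 : 0 < s) (hs2 : s < 2) :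
    Integrable (levyDensity N s) := by
  have : Nontrivial (Eucl N) :=
    Module.nontrivial_of_finrank_pos (R := ℝ) (by rw [finrank_euclideanSpace_fin]; omega)
  have h := integrable_fun_norm_addHaar (μ := (volume : Measure (Eucl N)))
    (f := fun y : ℝ => min 1 (y ^ 2) * y ^ (-((N : ℝ) + s)))
  refine h.2 ?_
  rw [finrank_euclideanSpace_fin, ← Ioc_union_Ioi_eq_Ioi (zero_le_one' ℝ), integrableOn_union]
  have hpow : ∀ y : ℝ, 0 < y → y ^ (N - 1) * y ^ (-((N : ℝ) + s)) = y ^ (-1 - s) := by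
    intro y hy
    rw [← Real.rpow_natCast, ← Real.rpow_add hy, Nat.cast_sub hN]
    congr 1; push_cast; ring
  constructor
  · have h1 : IntegrableOn (fun y : ℝ => y ^ (1 - s)) (Ioc 0 1) :=
      (intervalIntegrable_iff_integrableOn_Ioc_of_le zero_le_one).1
        (intervalIntegral.intervalIntegrable_rpow' (by linarith))
    refine h1.congr_fun (fun y hy => ?_) measurableSet_Ioc
    have hy2 : min 1 (y ^ 2) = y ^ 2 := min_eq_right (by nlinarith [hy.1, hy.2])
    simp only [hy2, smul_eq_mul]
    rw [mul_left_comm, hpow y hy.1, ← Real.rpow_natCast, ← Real.rpow_add hy.1]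
    congr 1; push_cast; ring
  · have h1 : IntegrableOn (fun y : ℝ => y ^ (-1 - s)) (Ioi 1) :=
      integrableOn_Ioi_rpow_of_lt (by linarith) zero_lt_one
    refine h1.congr_fun (fun y hy => ?_) measurableSet_Ioi
    have hy' : (1 : ℝ) < y := hy
    have hy2 : min 1 (y ^ 2) = 1 := min_eq_left (by nlinarith)
    simp only [hy2, smul_eq_mul, one_mul]
    rw [hpow y (by linarith)]

theorem lintegral_fst_mul_sub {f m : Eucl N → ℝ≥0∞} (hf : Measurable f) (hm : Measurable m) :
    ∫⁻ p : Eucl N × Eucl N, f p.1 * m (p.1 - p.2) = (∫⁻ x, f x) * ∫⁻ h, m h := by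
  rw [Measure.volume_eq_prod, lintegral_prod _ (by fun_prop)]
  rw [← lintegral_mul_const _ hf]
  refine lintegral_congr fun x => ?_
  dsimp only
  rw [lintegral_const_mul _ (by fun_prop), lintegral_sub_left_eq_self]

theorem lintegral_snd_mul_sub {f m : Eucl N → ℝ≥0∞} (hf : Measurable f) (hm : Measurable m) :
    ∫⁻ p : Eucl N × Eucl N, f p.2 * m (p.1 - p.2) = (∫⁻ x, f x) * ∫⁻ h, m h := by
  rw [Measure.volume_eq_prod, lintegral_prod_symm' _ (by fun_prop)]
  rw [← lintegral_mul_const _ hf]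
  refine lintegral_congr fun x => ?_
  dsimp only
  rw [lintegral_const_mul _ (by fun_prop), lintegral_sub_right_eq_self]

/-- The Gagliardo seminorm of a bounded Lipschitz function supported in `S`. -/
theorem lintegral_diff_sq_le {η : Eucl N → ℝ} {L : ℝ} {S : Set (Eucl N)} (hS : MeasurableSet S)
    (hη : ∀ x, x ∉ S → η x = 0) (hb : ∀ x y, |η x - η y| ≤ L)
    (hL : ∀ x y, |η x - η y| ≤ L * ‖x - y‖) :
    ∫⁻ p, ‖diff η p‖ₑ ^ 2 ∂gagliardoMeasure N s
      ≤ ENNReal.ofReal (L ^ 2) *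
        (2 * (volume S * ∫⁻ h, ENNReal.ofReal (levyDensity N s h))) := by
  have hm : Measurable fun h => ENNReal.ofReal (levyDensity N s h) :=
    measurable_levyDensity.ennreal_ofReal
  have hi : Measurable (S.indicator (1 : Eucl N → ℝ≥0∞)) := measurable_one.indicator hS
  have hL0 : 0 ≤ L := (abs_nonneg _).trans (hb 0 0)
  rw [gagliardoMeasure, lintegral_withDensity_eq_lintegral_mul_non_measurable _
    (measurable_gagliardoDensity N s).ennreal_ofReal (by simp)]
  -- The difference vanishes unless one of the two points lies in S. Each indicator then decouples
  -- from the Lévy density by translation in the other variable.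
  calc _ ≤ ∫⁻ p : Eucl N × Eucl N, ENNReal.ofReal (L ^ 2) *
        (S.indicator 1 p.1 * ENNReal.ofReal (levyDensity N s (p.1 - p.2))
          + S.indicator 1 p.2 * ENNReal.ofReal (levyDensity N s (p.1 - p.2))) := by
        refine lintegral_mono fun p => ?_
        simp only [Pi.mul_apply]
        rw [← add_mul]
        by_cases hp : p.1 ∈ S ∨ p.2 ∈ S
        · have h1 : (1 : ℝ≥0∞) ≤ S.indicator 1 p.1 + S.indicator 1 p.2 := by
            rcases hp with h | h <;> simp [h]
          refine le_trans ?_ (mul_le_mul_right (mul_le_mul_left h1 _) _)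
          rw [one_mul, Real.enorm_eq_ofReal_abs, ← ENNReal.ofReal_pow (abs_nonneg _), sq_abs,
            ← ENNReal.ofReal_mul (by positivity), ← ENNReal.ofReal_mul (by positivity)]
          refine ENNReal.ofReal_le_ofReal ?_
          rw [levyDensity, mul_comm, ← mul_assoc]
          refine mul_le_mul_of_nonneg_right ?_ (by positivity)
          rw [mul_min_of_nonneg _ _ (sq_nonneg L), mul_one, ← mul_pow]
          rw [← sq_abs (diff η p)]
          exact le_min (pow_le_pow_left₀ (abs_nonneg _) (hb p.1 p.2) 2)
            (pow_le_pow_left₀ (abs_nonneg _) (hL p.1 p.2) 2)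
        · rw [not_or] at hp
          simp [diff, hη _ hp.1, hη _ hp.2]
    _ = _ := by
        rw [lintegral_const_mul _ (by fun_prop), lintegral_add_left (by fun_prop),
          lintegral_fst_mul_sub hi hm, lintegral_snd_mul_sub hi hm, lintegral_indicator_one hS,
          two_mul]

theorem exists_bound_moll (N n : ℕ) : ∃ L : ℝ,
    (∀ x y, |moll N n x - moll N n y| ≤ L) ∧ ∀ x y, |moll N n x - moll N n y| ≤ L * ‖x - y‖ := by
  obtain ⟨K, hK⟩ := (contDiff_moll (N := N) n).lipschitzWith_of_hasCompactSupport
    (hasCompactSupport_moll n) (by simp)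
  obtain ⟨B, hB⟩ := (hasCompactSupport_moll n).exists_bound_of_continuous
    (continuous_moll (N := N) n)
  refine ⟨max (2 * B) K, fun x y => ?_, fun x y => ?_⟩
  · refine (abs_sub _ _).trans (le_trans ?_ (le_max_left _ _))
    have h1 := hB x
    have h2 := hB y
    rw [Real.norm_eq_abs] at h1 h2
    linarith
  · have := hK.dist_le_mul x y
    rw [Real.dist_eq, dist_eq_norm] at this
    exact this.trans (mul_le_mul_of_nonneg_right (le_max_right _ _) (norm_nonneg _))

theorem moll_eq_zero {n : ℕ} {x y : Eucl N} (h : y ∉ Metric.closedBall x (mollBump N n).rOut) :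
    moll N n (x - y) = 0 := by
  by_contra hne
  have h1 : x - y ∈ Function.support ((mollBump N n).normed volume) := by rwa [moll_def] at hne
  rw [(mollBump N n).support_normed_eq] at h1
  refine h (Metric.ball_subset_closedBall ?_)
  rw [mem_ball_zero_iff] at h1
  rwa [Metric.mem_ball, dist_comm, dist_eq_norm]

/-- Moving the centre x changes neither the Lipschitz constant nor the volume of the supporting
ball, so one bound serves every x. -/
theorem exists_bound_diff_moll (hN : 1 ≤ N) (hs0 : 0 < s) (hs2 : s < 2) (n : ℕ) :
    ∃ B : ℝ≥0∞, B ≠ ⊤ ∧ ∀ x, ∫⁻ p, ‖diff (fun y => moll N n (x - y)) p‖ₑ ^ 2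
      ∂gagliardoMeasure N s ≤ B := by
  obtain ⟨L, hL1, hL2⟩ := exists_bound_moll N n
  refine ⟨ENNReal.ofReal (L ^ 2) * (2 * (volume (Metric.closedBall (0 : Eucl N) (mollBump N n).rOut)
    * ∫⁻ h, ENNReal.ofReal (levyDensity N s h))), ?_, fun x => ?_⟩
  · refine ENNReal.mul_ne_top (by simp) (ENNReal.mul_ne_top (by simp) (ENNReal.mul_ne_top
      measure_closedBall_lt_top.ne ?_))
    rw [← ofReal_integral_eq_lintegral_ofReal (integrable_levyDensity hN hs0 hs2)
      (Eventually.of_forall levyDensity_nonneg)]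
    simp
  · refine (lintegral_diff_sq_le (S := Metric.closedBall x (mollBump N n).rOut)
      measurableSet_closedBall (fun y hy => moll_eq_zero hy) (fun y z => hL1 _ _)
      (fun y z => ?_)).trans
      (le_of_eq ?_)
    · refine (hL2 _ _).trans (le_of_eq ?_)
      rw [← norm_neg (y - z)]; congr 2; abel
    · rw [Measure.addHaar_closedBall_center]

theorem measurable_diff_moll (n : ℕ) :
    Measurable fun q : Eucl N × Eucl N × Eucl N => diff (fun y => moll N n (q.1 - y)) q.2 := by
  have h1 : Measurable fun q : Eucl N × Eucl N × Eucl N => q.1 - q.2.1 := by fun_prop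
  have h2 : Measurable fun q : Eucl N × Eucl N × Eucl N => q.1 - q.2.2 := by fun_prop
  exact ((continuous_moll n).measurable.comp h1).sub ((continuous_moll n).measurable.comp h2)

/-- The indicator function of `|x - y| ≤ R`. -/
noncomputable def nearIndicator (R : ℝ) (q : Eucl N × Eucl N) : ℝ≥0∞ :=
  {q : Eucl N × Eucl N | dist q.1 q.2 ≤ R}.indicator 1 q

theorem measurable_nearIndicator (R : ℝ) : Measurable (nearIndicator (N := N) R) :=
  measurable_one.indicator (measurableSet_le (measurable_fst.dist measurable_snd) measurable_const)

theorem nearIndicator_eq_one {R : ℝ} {x y : Eucl N} (h : y ∈ Metric.closedBall x R) :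
    nearIndicator R (x, y) = 1 :=
  indicator_of_mem (by rwa [Metric.mem_closedBall, dist_comm] at h) _

theorem lintegral_nearIndicator (R : ℝ) (y : Eucl N) :
    ∫⁻ x, nearIndicator R (x, y) = volume (Metric.closedBall (0 : Eucl N) R) := by
  rw [← Measure.addHaar_closedBall_center volume y,
    ← lintegral_indicator_one measurableSet_closedBall]
  refine lintegral_congr fun x => ?_
  by_cases h : dist x y ≤ R
  · rw [nearIndicator, indicator_of_mem (by exact h), indicator_of_mem (by exact h)]; rfl
  · rw [nearIndicator, indicator_of_notMem (by exact h), indicator_of_notMem (by exact h)]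

/-- The bound that justifies Fubini's theorem when the equation is tested with mollifiers. -/
theorem exists_bound_lintegral_diff_moll (hN : 1 ≤ N) (hs0 : 0 < s) (hs2 : s < 2) (n : ℕ) :
    ∃ B : ℝ≥0∞, B ≠ ⊤ ∧ ∀ u v : Eucl N → ℝ, Measurable u → Measurable v →
      ∫⁻ x, ∫⁻ p, ‖v x‖ₑ * ‖diff u p‖ₑ * ‖diff (fun y => moll N n (x - y)) p‖ₑ ∂gagliardoMeasure N s
        ≤ B * (eLpNorm v 2 volume ^ 2 + eLpNorm (diff u) 2 (gagliardoMeasure N s) ^ 2) := by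
  obtain ⟨B, hB, hBb⟩ := exists_bound_diff_moll (s := s) hN hs0 hs2 n
  set V := volume (Metric.closedBall (0 : Eucl N) (mollBump N n).rOut) with hV
  have hVt : V ≠ ⊤ := measure_closedBall_lt_top.ne
  refine ⟨B + (V + V), ENNReal.add_ne_top.2 ⟨hB, ENNReal.add_ne_top.2 ⟨hVt, hVt⟩⟩,
    fun u v hu hv => ?_⟩
  have hd := measurable_diff hu
  set R := (mollBump N n).rOut
  have hχ1 : Measurable fun q : Eucl N × Eucl N × Eucl N => nearIndicator R (q.1, q.2.1) :=
    (measurable_nearIndicator R).comp (measurable_fst.prodMk measurable_snd.fst)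
  have hχ2 : Measurable fun q : Eucl N × Eucl N × Eucl N => nearIndicator R (q.1, q.2.2) :=
    (measurable_nearIndicator R).comp (measurable_fst.prodMk measurable_snd.snd)
  have hχint : ∀ y, ∫⁻ x, nearIndicator R (x, y) = V := lintegral_nearIndicator R
  have hm := measurable_diff_moll (N := N) n
  -- Young's inequality with `v x` paired with the mollifier. The term left with `diff u` keeps the
  -- condition that a point of p is close to x, without which its integral in x would diverge.
  calc _ ≤ ∫⁻ x, ∫⁻ p, (‖v x‖ₑ ^ 2 * ‖diff (fun y => moll N n (x - y)) p‖ₑ ^ 2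
          + (nearIndicator R (x, p.1) + nearIndicator R (x, p.2)) * ‖diff u p‖ₑ ^ 2)
          ∂gagliardoMeasure N s := by
        refine lintegral_mono fun x => lintegral_mono fun p => ?_
        by_cases hp : p.1 ∈ Metric.closedBall x R ∨ p.2 ∈ Metric.closedBall x R
        · have h1 : (1 : ℝ≥0∞) ≤ nearIndicator R (x, p.1) + nearIndicator R (x, p.2) := by
            rcases hp with h | h <;> rw [nearIndicator_eq_one h]
            · exact le_self_add
            · exact le_add_self
          refine le_trans ?_ (add_le_add le_rfl (mul_le_mul_left h1 _))
          rw [one_mul, mul_right_comm, ← mul_pow]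
          rcases le_total (‖v x‖ₑ * ‖diff (fun y => moll N n (x - y)) p‖ₑ) ‖diff u p‖ₑ with h | h
          · refine le_trans ?_ le_add_self
            rw [sq]; exact mul_le_mul_left h _
          · refine le_trans ?_ le_self_add
            rw [sq]; exact mul_le_mul_right h _
        · rw [not_or] at hp
          have : diff (fun y => moll N n (x - y)) p = 0 := by
            simp [diff, moll_eq_zero hp.1, moll_eq_zero hp.2]
          simp [this]
    _ = (∫⁻ x, ‖v x‖ₑ ^ 2 * ∫⁻ p, ‖diff (fun y => moll N n (x - y)) p‖ₑ ^ 2 ∂gagliardoMeasure N s)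
        + ∫⁻ x, ∫⁻ p, (nearIndicator R (x, p.1) + nearIndicator R (x, p.2)) * ‖diff u p‖ₑ ^ 2
          ∂gagliardoMeasure N s := by
        have hm2 : Measurable fun x =>
            ∫⁻ p, ‖diff (fun y => moll N n (x - y)) p‖ₑ ^ 2 ∂gagliardoMeasure N s :=
          (hm.enorm.pow_const 2).lintegral_prod_right'
        have hm3 : Measurable fun x => ‖v x‖ₑ ^ 2 *
            ∫⁻ p, ‖diff (fun y => moll N n (x - y)) p‖ₑ ^ 2 ∂gagliardoMeasure N s :=
          (hv.enorm.pow_const 2).mul hm2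
        rw [← lintegral_add_left hm3]
        refine lintegral_congr fun x => ?_
        have hmx : Measurable fun p => ‖diff (fun y => moll N n (x - y)) p‖ₑ ^ 2 :=
          (hm.comp measurable_prodMk_left).enorm.pow_const 2
        have hmx2 : Measurable fun p => ‖v x‖ₑ ^ 2 * ‖diff (fun y => moll N n (x - y)) p‖ₑ ^ 2 :=
          hmx.const_mul _
        rw [lintegral_add_left hmx2, lintegral_const_mul _ hmx]
    _ ≤ (∫⁻ x, ‖v x‖ₑ ^ 2 * B)
        + ∫⁻ p, (V + V) * ‖diff u p‖ₑ ^ 2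
          ∂gagliardoMeasure N s := by
        have h1 : ∀ x, ‖v x‖ₑ ^ 2 *
            ∫⁻ p, ‖diff (fun y => moll N n (x - y)) p‖ₑ ^ 2 ∂gagliardoMeasure N s
            ≤ ‖v x‖ₑ ^ 2 * B := fun x => mul_le_mul_right (hBb x) _
        refine add_le_add (lintegral_mono h1) (le_of_eq ?_)
        have h2 : Measurable fun q : Eucl N × Eucl N × Eucl N =>
            (nearIndicator R (q.1, q.2.1) + nearIndicator R (q.1, q.2.2)) * ‖diff u q.2‖ₑ ^ 2 :=
          (hχ1.add hχ2).mul ((hd.comp measurable_snd).enorm.pow_const 2)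
        rw [lintegral_lintegral_swap h2.aemeasurable]
        refine lintegral_congr fun p => ?_
        have m1 : Measurable fun x => nearIndicator R (x, p.1) :=
          (measurable_nearIndicator R).comp measurable_prodMk_right
        have m2 : Measurable fun x => nearIndicator R (x, p.2) :=
          (measurable_nearIndicator R).comp measurable_prodMk_right
        have m3 : Measurable fun x => nearIndicator R (x, p.1) + nearIndicator R (x, p.2) :=
          m1.add m2
        rw [lintegral_mul_const _ m3, lintegral_add_left m1, hχint, hχint]
    _ = B * eLpNorm v 2 volume ^ 2
        + (V + V) * eLpNorm (diff u) 2 (gagliardoMeasure N s) ^ 2 := by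
        rw [lintegral_mul_const _ (by fun_prop), lintegral_const_mul _ (by fun_prop),
          eLpNorm_two_sq, eLpNorm_two_sq, mul_comm]
    _ ≤ _ := by
        rw [mul_add]
        exact add_le_add (mul_le_mul_left le_self_add _) (mul_le_mul_left le_add_self _)

end KernelBounds

/-! ### The energy form: Cauchy–Schwarz, mollified test functions, and Fubini. -/

section EnergyForm

open Filter Topology Measure

variable {N : ℕ} {s C : ℝ} {κ : Eucl N × Eucl N → ℝ} {u v : Eucl N → ℝ} {φ : ℝ → ℝ}

/-- The form `∬ κ(x,y) (u(x) - u(y)) (v(x) - v(y)) |x - y|^{-(N+s)} dx dy`. -/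
noncomputable def energyForm (s : ℝ) (κ : Eucl N × Eucl N → ℝ) (u v : Eucl N → ℝ) : ℝ :=
  ∫ p, κ p * diff u p * diff v p ∂gagliardoMeasure N s

theorem enorm_le_of_nonneg_of_le {a : ℝ} (h0 : 0 ≤ a) (h1 : a ≤ C) : ‖a‖ₑ ≤ ENNReal.ofReal C := by
  rw [Real.enorm_eq_ofReal h0]
  exact ENNReal.ofReal_le_ofReal h1

theorem lintegral_energy_le (hκ0 : ∀ p, 0 ≤ κ p) (hκC : ∀ p, κ p ≤ C)
    (hu : AEStronglyMeasurable (diff u) (gagliardoMeasure N s))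
    {h : Eucl N × Eucl N → ℝ} (hh : AEStronglyMeasurable h (gagliardoMeasure N s)) :
    ∫⁻ p, ‖κ p * diff u p * h p‖ₑ ∂gagliardoMeasure N s
      ≤ ENNReal.ofReal C * (eLpNorm (diff u) 2 (gagliardoMeasure N s)
        * eLpNorm h 2 (gagliardoMeasure N s)) := by
  have h1 := eLpNorm_smul_le_mul_eLpNorm (p := 2) (q := 2) (r := 1) hh hu
  rw [eLpNorm_one_eq_lintegral_enorm] at h1
  refine le_trans ?_ (mul_le_mul_right h1 _)
  rw [← lintegral_const_mul' _ _ ENNReal.ofReal_ne_top]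
  refine lintegral_mono fun p => ?_
  rw [mul_assoc, enorm_mul]
  exact mul_le_mul_left (enorm_le_of_nonneg_of_le (hκ0 p) (hκC p)) _

theorem integrable_energy (hκ : Measurable κ) (hκ0 : ∀ p, 0 ≤ κ p) (hκC : ∀ p, κ p ≤ C)
    (hu : MemLp (diff u) 2 (gagliardoMeasure N s)) {h : Eucl N × Eucl N → ℝ}
    (hh : MemLp h 2 (gagliardoMeasure N s)) :
    Integrable (fun p => κ p * diff u p * h p) (gagliardoMeasure N s) :=
  ⟨(hκ.aestronglyMeasurable.mul hu.1).mul hh.1,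
    (lintegral_energy_le hκ0 hκC hu.1 hh.1).trans_lt
      (ENNReal.mul_lt_top ENNReal.ofReal_lt_top (ENNReal.mul_lt_top hu.2 hh.2))⟩

theorem enorm_energyForm_le (hκ0 : ∀ p, 0 ≤ κ p) (hκC : ∀ p, κ p ≤ C)
    (hu : MemLp (diff u) 2 (gagliardoMeasure N s)) (hv : MemLp (diff v) 2 (gagliardoMeasure N s)) :
    ‖energyForm s κ u v‖ₑ ≤ ENNReal.ofReal C * (eLpNorm (diff u) 2 (gagliardoMeasure N s)
        * eLpNorm (diff v) 2 (gagliardoMeasure N s)) :=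
  (enorm_integral_le_lintegral_enorm _).trans (lintegral_energy_le hκ0 hκC hu.1 hv.1)

/-- A contraction of the real line fixing `0`. -/
structure IsContraction (φ : ℝ → ℝ) : Prop where
  abs_sub_le : ∀ a b, |φ a - φ b| ≤ |a - b|
  map_zero : φ 0 = 0

namespace IsContraction

theorem continuous (hφ : IsContraction φ) : Continuous φ :=
  (LipschitzWith.of_dist_le_mul (K := 1) fun a b => by
    simpa [Real.dist_eq] using hφ.abs_sub_le a b).continuous

theorem abs_le (hφ : IsContraction φ) (a : ℝ) : |φ a| ≤ |a| := by
  simpa [hφ.map_zero] using hφ.abs_sub_le a 0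

theorem measurable_comp (hφ : IsContraction φ) (hu : Measurable u) : Measurable (φ ∘ u) :=
  hφ.continuous.measurable.comp hu

theorem memLp_comp (hφ : IsContraction φ) (hu : MemLp u 2 volume) : MemLp (φ ∘ u) 2 volume :=
  hu.mono (hφ.continuous.comp_aestronglyMeasurable hu.1)
    (Eventually.of_forall fun _ => hφ.abs_le _)

theorem eLpNorm_comp_le (hφ : IsContraction φ) : eLpNorm (φ ∘ u) 2 volume ≤ eLpNorm u 2 volume :=
  eLpNorm_mono fun _ => hφ.abs_le _

theorem eLpNorm_diff_comp_le (hφ : IsContraction φ) :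
    eLpNorm (diff (φ ∘ u)) 2 (gagliardoMeasure N s) ≤ eLpNorm (diff u) 2 (gagliardoMeasure N s) :=
  eLpNorm_mono fun _ => hφ.abs_sub_le _ _

theorem memLp_diff_comp (hφ : IsContraction φ) (hu : Measurable u)
    (hd : MemLp (diff u) 2 (gagliardoMeasure N s)) :
    MemLp (diff (φ ∘ u)) 2 (gagliardoMeasure N s) :=
  ⟨(measurable_diff (hφ.measurable_comp hu)).aestronglyMeasurable,
    hφ.eLpNorm_diff_comp_le.trans_lt hd.2⟩

end IsContraction

theorem isContraction_posPart {c : ℝ} (hc : 0 ≤ c) : IsContraction fun a => max (a - c) 0 where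
  abs_sub_le a b := (abs_max_sub_max_le_abs _ _ _).trans (le_of_eq (by congr 1; ring))
  map_zero := max_eq_right (by linarith)

theorem tendsto_energyForm_mol (hκ : Measurable κ) (hκ0 : ∀ p, 0 ≤ κ p) (hκC : ∀ p, κ p ≤ C)
    (hu : Measurable u) (hu2 : MemLp u 2 volume) (hd : MemLp (diff u) 2 (gagliardoMeasure N s))
    (hφ : IsContraction φ) :
    Tendsto (fun n => energyForm s κ u (mol n (φ ∘ mol n u))) atTop
      (𝓝 (energyForm s κ u (φ ∘ u))) := by
  rw [tendsto_iff_edist_tendsto_0]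
  have h1 := tendsto_eLpNorm_diff_mol_comp_mol hu hu2 hd hφ.abs_sub_le hφ.map_zero
  have h2 := ENNReal.Tendsto.const_mul (a := ENNReal.ofReal C *
    eLpNorm (diff u) 2 (gagliardoMeasure N s)) h1
    (Or.inr (ENNReal.mul_ne_top ENNReal.ofReal_ne_top hd.2.ne))
  rw [mul_zero] at h2
  refine tendsto_of_tendsto_of_tendsto_of_le_of_le tendsto_const_nhds h2 (fun _ => zero_le)
    fun n => ?_
  have hm := measurable_mol hu n
  have hw : MemLp (diff (mol n (φ ∘ mol n u))) 2 (gagliardoMeasure N s) :=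
    memLp_diff_mol (hφ.measurable_comp hm) (hφ.memLp_comp (memLp_mol hu hu2 n))
      (hφ.memLp_diff_comp hm (memLp_diff_mol hu hu2 hd n)) n
  have hw' := hφ.memLp_diff_comp hu hd
  dsimp only
  rw [edist_eq_enorm_sub, energyForm, energyForm,
    ← integral_sub (integrable_energy hκ hκ0 hκC hd hw) (integrable_energy hκ hκ0 hκC hd hw')]
  refine (enorm_integral_le_lintegral_enorm _).trans ?_
  rw [mul_assoc]
  refine le_trans (le_of_eq (lintegral_congr fun p => ?_))
    (lintegral_energy_le hκ0 hκC hd.1 (hw.1.sub hw'.1))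
  rw [Pi.sub_apply, mul_sub]

/-- The bound does not depend on n, and so dominates the integrands in time when n tends to
infinity. -/
theorem enorm_energyForm_mol_le (hκ0 : ∀ p, 0 ≤ κ p) (hκC : ∀ p, κ p ≤ C)
    (hu : Measurable u) (hu2 : MemLp u 2 volume) (hd : MemLp (diff u) 2 (gagliardoMeasure N s))
    (hφ : IsContraction φ) (n : ℕ) :
    ‖energyForm s κ u (mol n (φ ∘ mol n u))‖ₑ
      ≤ ENNReal.ofReal C * eLpNorm (diff u) 2 (gagliardoMeasure N s) ^ 2 := by
  have hm := measurable_mol hu n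
  have hv2 := hφ.memLp_comp (memLp_mol hu hu2 n)
  have hvd := hφ.memLp_diff_comp hm (memLp_diff_mol hu hu2 hd n)
  refine (enorm_energyForm_le hκ0 hκC hd
    (memLp_diff_mol (hφ.measurable_comp hm) hv2 hvd n)).trans ?_
  rw [sq]
  refine mul_le_mul_right (mul_le_mul_right ?_ _) _
  exact ((eLpNorm_diff_mol_le (hφ.measurable_comp hm) hv2 n).trans hφ.eLpNorm_diff_comp_le).trans
    (eLpNorm_diff_mol_le hu hu2 n)

/-- The constant is fixed before the kernel and the functions because it is used at all times at
once; the remaining factor is then integrated in time by the energy bound. -/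
theorem exists_bound_lintegral_energyForm_moll (hN : 1 ≤ N) (hs0 : 0 < s) (hs2 : s < 2) (C : ℝ)
    (n : ℕ) : ∃ B : ℝ≥0∞, B ≠ ⊤ ∧ ∀ (κ : Eucl N × Eucl N → ℝ) (u v : Eucl N → ℝ),
      (∀ p, 0 ≤ κ p) → (∀ p, κ p ≤ C) → Measurable u → Measurable v →
      ∫⁻ x, ∫⁻ p, ‖v x * (κ p * diff u p * diff (fun y => moll N n (x - y)) p)‖ₑ
          ∂gagliardoMeasure N s
        ≤ B * (eLpNorm v 2 volume ^ 2 + eLpNorm (diff u) 2 (gagliardoMeasure N s) ^ 2) := by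
  obtain ⟨B, hB, h⟩ := exists_bound_lintegral_diff_moll hN hs0 hs2 n
  refine ⟨ENNReal.ofReal C * B, ENNReal.mul_ne_top ENNReal.ofReal_ne_top hB,
    fun κ u v hκ0 hκC hu hv => ?_⟩
  rw [mul_assoc]
  refine le_trans ?_ (mul_le_mul_right (h u v hu hv) _)
  rw [← lintegral_const_mul' _ _ ENNReal.ofReal_ne_top]
  refine lintegral_mono fun x => ?_
  rw [← lintegral_const_mul' _ _ ENNReal.ofReal_ne_top]
  refine lintegral_mono fun p => ?_
  rw [enorm_mul, enorm_mul, enorm_mul]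
  calc _ = ‖κ p‖ₑ * (‖v x‖ₑ * ‖diff u p‖ₑ * ‖diff (fun y => moll N n (x - y)) p‖ₑ) := by ring
    _ ≤ _ := mul_le_mul_left (enorm_le_of_nonneg_of_le (hκ0 p) (hκC p)) _

/-- Fubini's theorem for the form tested with translated mollifiers. -/
theorem integral_mul_energyForm_moll (hN : 1 ≤ N) (hs0 : 0 < s) (hs2 : s < 2)
    (hκ : Measurable κ) (hκ0 : ∀ p, 0 ≤ κ p) (hκC : ∀ p, κ p ≤ C) (hu : Measurable u)
    (hd : MemLp (diff u) 2 (gagliardoMeasure N s)) (hv : Measurable v) (hv2 : MemLp v 2 volume)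
    (n : ℕ) :
    ∫ x, v x * energyForm s κ u (fun y => moll N n (x - y)) = energyForm s κ u (mol n v) := by
  obtain ⟨B, hB, h⟩ := exists_bound_lintegral_energyForm_moll hN hs0 hs2 C n
  have hmeas : Measurable fun q : Eucl N × Eucl N × Eucl N =>
      v q.1 * (κ q.2 * diff u q.2 * diff (fun y => moll N n (q.1 - y)) q.2) :=
    (hv.comp measurable_fst).mul (((hκ.comp measurable_snd).mul
      ((measurable_diff hu).comp measurable_snd)).mul (measurable_diff_moll n))
  have hint : Integrable (Function.uncurry fun x p =>
      v x * (κ p * diff u p * diff (fun y => moll N n (x - y)) p))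
      ((volume : Measure (Eucl N)).prod (gagliardoMeasure N s)) := by
    refine ⟨hmeas.aestronglyMeasurable, ?_⟩
    rw [HasFiniteIntegral]
    refine (lintegral_prod _ hmeas.enorm.aemeasurable).trans_lt ?_
    exact (h κ u v hκ0 hκC hu hv).trans_lt (ENNReal.mul_lt_top hB.lt_top
      (ENNReal.add_lt_top.2 ⟨ENNReal.pow_lt_top hv2.2, ENNReal.pow_lt_top hd.2⟩))
  have hswap := integral_integral_swap hint
  simp only [energyForm]
  simp_rw [← integral_const_mul]
  rw [hswap]
  refine integral_congr_ae (Eventually.of_forall fun p => ?_)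
  dsimp only
  have hi : ∀ y : Eucl N, Integrable fun x => v x * moll N n (x - y) := fun y =>
    hv2.integrable_mul
      ((memLp_moll n).comp_measurePreserving (measurePreserving_sub_right volume y))
  -- Here the mollifier is centred at the integration variable; it is even, so the result is still
  -- `mol n v y`.
  have hm : ∀ y : Eucl N, mol n v y = ∫ x, v x * moll N n (x - y) := fun y => by
    rw [mol_eq]
    refine integral_congr_ae (Eventually.of_forall fun x => ?_)
    dsimp only
    rw [← moll_neg, neg_sub]
  rw [show diff (mol n v) p = mol n v p.1 - mol n v p.2 from rfl, hm, hm,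
    ← integral_sub (hi _) (hi _), ← integral_const_mul]
  refine integral_congr_ae (Eventually.of_forall fun x => ?_)
  simp only [diff]
  ring

end EnergyForm

/-! ### Regular representatives and the chain rule for the mollified solution. -/

section EnergyIdentity

open Filter Topology Measure

variable {N : ℕ} {s C : ℝ} {κ : ℝ → Eucl N × Eucl N → ℝ} {w₀ : Eucl N → ℝ} {w : ℝ → Eucl N → ℝ}

/-- The squared `H^{s/2}` norm. -/
noncomputable def sobolevSq (s : ℝ) (u : Eucl N → ℝ) : ℝ≥0∞ :=
  eLpNorm u 2 volume ^ 2 + eLpNorm (diff u) 2 (gagliardoMeasure N s) ^ 2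

/-- A weak solution, represented so that everything is measurable and every time slice belongs to
`H^{s/2}`; the kernel is `κ(t,x,y) |x - y|^{-(N+s)}`. -/
structure IsRegularSolution (s C : ℝ) (κ : ℝ → Eucl N × Eucl N → ℝ) (w₀ : Eucl N → ℝ)
    (w : ℝ → Eucl N → ℝ) : Prop where
  measurable_kernel : Measurable (Function.uncurry κ)
  kernel_nonneg : ∀ t p, 0 ≤ κ t p
  kernel_le : ∀ t p, κ t p ≤ C
  measurable_init : Measurable w₀
  memLp_init : MemLp w₀ 2 volume
  measurable : Measurable (Function.uncurry w)
  memLp : ∀ t, MemLp (w t) 2 volume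
  memLp_diff : ∀ t, MemLp (diff (w t)) 2 (gagliardoMeasure N s)
  energy : ∀ T > 0, ∫⁻ t in Ioo 0 T, sobolevSq s (w t) < ⊤
  weak : ∀ n x, ∀ᵐ t ∂(volume.restrict (Ioi (0 : ℝ))),
    mol n (w t) x = mol n w₀ x
      - ∫ r in Ioo 0 t, (1 / 2) * energyForm s (κ r) (w r) (fun y => moll N n (x - y))

theorem measurable_energyForm {γ : Type*} [MeasurableSpace γ] {k : γ → Eucl N × Eucl N → ℝ}
    {u v : γ → Eucl N → ℝ} (hk : Measurable (Function.uncurry k))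
    (hu : Measurable (Function.uncurry u)) (hv : Measurable (Function.uncurry v)) :
    Measurable fun r => energyForm s (k r) (u r) (v r) := by
  have h1 : Measurable fun q : γ × Eucl N × Eucl N => (q.1, q.2.1) := by fun_prop
  have h2 : Measurable fun q : γ × Eucl N × Eucl N => (q.1, q.2.2) := by fun_prop
  have h : Measurable fun q : γ × Eucl N × Eucl N =>
      k q.1 q.2 * (u q.1 q.2.1 - u q.1 q.2.2) * (v q.1 q.2.1 - v q.1 q.2.2) :=
    (hk.mul ((hu.comp h1).sub (hu.comp h2))).mul ((hv.comp h1).sub (hv.comp h2))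
  exact h.stronglyMeasurable.integral_prod_right.measurable

theorem measurable_eLpNorm_sq {γ : Type*} [MeasurableSpace γ] {α : Type*} [MeasurableSpace α]
    {μ : Measure α} [SFinite μ] {f : γ → α → ℝ} (hf : Measurable (Function.uncurry f)) :
    Measurable fun r => eLpNorm (f r) 2 μ ^ 2 := by
  simp_rw [eLpNorm_two_sq]
  exact (hf.enorm.pow_const 2).lintegral_prod_right'

theorem tendsto_eLpNorm_of_sub {α : Type*} [MeasurableSpace α] {μ : Measure α} {f : ℕ → α → ℝ}
    {g : α → ℝ} (hf : ∀ n, AEStronglyMeasurable (f n) μ) (hg : AEStronglyMeasurable g μ)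
    (h : Tendsto (fun n => eLpNorm (f n - g) 2 μ) atTop (𝓝 0)) (hgt : eLpNorm g 2 μ ≠ ⊤) :
    Tendsto (fun n => eLpNorm (f n) 2 μ) atTop (𝓝 (eLpNorm g 2 μ)) := by
  have h1 := ENNReal.Tendsto.sub (tendsto_const_nhds (x := eLpNorm g 2 μ)) h (Or.inl hgt)
  have h2 := h.const_add (eLpNorm g 2 μ)
  rw [tsub_zero] at h1
  rw [add_zero] at h2
  refine tendsto_of_tendsto_of_tendsto_of_le_of_le h1 h2 (fun n => ?_) fun n => ?_
  · refine tsub_le_iff_right.2 ?_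
    calc eLpNorm g 2 μ = eLpNorm (f n - (f n - g)) 2 μ := by rw [sub_sub_cancel]
      _ ≤ _ := eLpNorm_sub_le (hf n) ((hf n).sub hg) (by norm_num)
  · calc eLpNorm (f n) 2 μ = eLpNorm (g + (f n - g)) 2 μ := by rw [add_sub_cancel]
      _ ≤ _ := eLpNorm_add_le hg ((hf n).sub hg) (by norm_num)

theorem integral_sq_eq {α : Type*} [MeasurableSpace α] {μ : Measure α} {f : α → ℝ}
    (hf : AEStronglyMeasurable f μ) : ∫ x, f x ^ 2 ∂μ = (eLpNorm f 2 μ ^ 2).toReal := by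
  rw [eLpNorm_two_sq, integral_eq_lintegral_of_nonneg_ae (Eventually.of_forall fun x => sq_nonneg _)
    (hf.pow 2)]
  congr 1
  refine lintegral_congr fun x => ?_
  rw [Real.enorm_eq_ofReal_abs, ← ENNReal.ofReal_pow (abs_nonneg _), sq_abs]

theorem IsContraction.tendsto_integral_sq_mol {φ : ℝ → ℝ} (hφ : IsContraction φ) {u : Eucl N → ℝ}
    (hu : Measurable u) (hu2 : MemLp u 2 volume) :
    Tendsto (fun n => ∫ x, φ (mol n u x) ^ 2) atTop (𝓝 (∫ x, φ (u x) ^ 2)) := by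
  have hm := fun n => (hφ.measurable_comp (measurable_mol hu n)).aestronglyMeasurable
    (μ := (volume : Measure (Eucl N)))
  have hm' := (hφ.measurable_comp hu).aestronglyMeasurable (μ := (volume : Measure (Eucl N)))
  have h0 : Tendsto (fun n => eLpNorm (φ ∘ mol n u - φ ∘ u) 2 volume) atTop (𝓝 0) :=
    tendsto_of_tendsto_of_tendsto_of_le_of_le tendsto_const_nhds (tendsto_eLpNorm_mol_sub hu hu2)
      (fun _ => zero_le) fun n => eLpNorm_mono fun x => hφ.abs_sub_le _ _
  have h1 := tendsto_eLpNorm_of_sub hm hm' h0 (hφ.memLp_comp hu2).2.ne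
  have h2 := (ENNReal.continuous_pow 2).continuousAt.tendsto.comp h1
  have h3 := (ENNReal.tendsto_toReal (ENNReal.pow_ne_top (hφ.memLp_comp hu2).2.ne)).comp h2
  have e := integral_sq_eq hm'
  have e' := fun n => integral_sq_eq (hm n)
  simp only [Function.comp_apply] at e e'
  rw [e]
  exact h3.congr fun n => (e' n).symm

theorem measurable_moll_sub (n : ℕ) :
    Measurable (Function.uncurry fun (x y : Eucl N) => moll N n (x - y)) :=
  (continuous_moll n).measurable.comp measurable_sub

namespace IsRegularSolution

theorem measurable_slice (h : IsRegularSolution s C κ w₀ w) (t : ℝ) : Measurable (w t) :=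
  h.measurable.comp measurable_prodMk_left

theorem measurable_kernel_slice (h : IsRegularSolution s C κ w₀ w) (t : ℝ) : Measurable (κ t) :=
  h.measurable_kernel.comp measurable_prodMk_left

theorem measurable_sobolevSq (h : IsRegularSolution s C κ w₀ w) :
    Measurable fun t => sobolevSq s (w t) := by
  refine (measurable_eLpNorm_sq h.measurable).add (measurable_eLpNorm_sq ?_)
  have h1 : Measurable fun q : ℝ × Eucl N × Eucl N => (q.1, q.2.1) := by fun_prop
  have h2 : Measurable fun q : ℝ × Eucl N × Eucl N => (q.1, q.2.2) := by fun_prop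
  exact (h.measurable.comp h1).sub (h.measurable.comp h2)

theorem measurable_energyForm_moll (h : IsRegularSolution s C κ w₀ w) (n : ℕ) :
    Measurable fun q : ℝ × Eucl N =>
    energyForm s (κ q.1) (w q.1) (fun y => moll N n (q.2 - y)) := by
  refine measurable_energyForm (k := fun q : ℝ × Eucl N => κ q.1) (u := fun q => w q.1)
    (v := fun q y => moll N n (q.2 - y)) ?_ ?_ ?_
  · exact h.measurable_kernel.comp (measurable_fst.fst.prodMk measurable_snd)
  · exact h.measurable.comp (measurable_fst.fst.prodMk measurable_snd)
  · exact (measurable_moll_sub n).comp (measurable_fst.snd.prodMk measurable_snd)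

theorem intervalIntegrable_energyForm_moll (h : IsRegularSolution s C κ w₀ w) (hN : 1 ≤ N)
    (hs0 : 0 < s) (hs2 : s < 2) (n : ℕ)
    (x : Eucl N) {T : ℝ} (hT : 0 < T) : IntervalIntegrable (fun r =>
      (1 / 2) * energyForm s (κ r) (w r) (fun y => moll N n (x - y))) volume 0 T := by
  obtain ⟨B, hB, hBb⟩ := exists_bound_diff_moll (N := N) hN hs0 hs2 n
  refine IntervalIntegrable.const_mul ?_ _
  rw [intervalIntegrable_iff_integrableOn_Ioo_of_le hT.le]
  have hmd : Measurable (diff fun y => moll N n (x - y)) :=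
    (measurable_diff_moll n).comp measurable_prodMk_left
  have hmemB : eLpNorm (diff fun y => moll N n (x - y)) 2 (gagliardoMeasure N s) ^ 2 ≤ B := by
    rw [eLpNorm_two_sq]; exact hBb x
  have hmem : MemLp (diff fun y => moll N n (x - y)) 2 (gagliardoMeasure N s) := by
    refine ⟨hmd.aestronglyMeasurable, ?_⟩
    by_contra hcon
    rw [not_lt, top_le_iff] at hcon
    rw [hcon] at hmemB
    exact hB (top_le_iff.1 (by simpa using hmemB))
  refine ⟨((h.measurable_energyForm_moll n).comp
    (measurable_id.prodMk measurable_const)).aestronglyMeasurable, ?_⟩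
  have hle : ∀ r, ‖energyForm s (κ r) (w r) (fun y => moll N n (x - y))‖ₑ
      ≤ ENNReal.ofReal C * (sobolevSq s (w r) + B) := fun r => by
    refine (enorm_energyForm_le (h.kernel_nonneg r) (h.kernel_le r) (h.memLp_diff r) hmem).trans
      (mul_le_mul_right ?_ _)
    refine le_trans ?_ (add_le_add le_add_self hmemB)
    rcases le_total (eLpNorm (diff (w r)) 2 (gagliardoMeasure N s))
      (eLpNorm (diff fun y => moll N n (x - y)) 2 (gagliardoMeasure N s)) with h1 | h1
    · refine le_trans ?_ le_add_self
      rw [sq]; exact mul_le_mul_left h1 _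
    · refine le_trans ?_ le_self_add
      rw [sq]; exact mul_le_mul_right h1 _
  refine (lintegral_mono hle).trans_lt ?_
  rw [lintegral_const_mul' _ _ ENNReal.ofReal_ne_top, lintegral_add_left h.measurable_sobolevSq]
  refine ENNReal.mul_lt_top ENNReal.ofReal_lt_top (ENNReal.add_lt_top.2 ⟨h.energy T hT, ?_⟩)
  rw [lintegral_const]
  exact ENNReal.mul_lt_top hB.lt_top (by simp)

/-- The chain rule at a fixed point, for the mollified solution. -/
theorem ae_sq_posPart_mol (h : IsRegularSolution s C κ w₀ w) (hN : 1 ≤ N)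
    (hs0 : 0 < s) (hs2 : s < 2) (c : ℝ) (n : ℕ) (x : Eucl N) :
    ∀ᵐ t ∂(volume.restrict (Ioi (0 : ℝ))),
      max (mol n (w t) x - c) 0 ^ 2 - max (mol n w₀ x - c) 0 ^ 2
        = -∫ r in Ioo 0 t, max (mol n (w r) x - c) 0
            * energyForm s (κ r) (w r) (fun y => moll N n (x - y)) := by
  have hw := h.weak n x
  filter_upwards [hw, ae_restrict_mem measurableSet_Ioi] with t ht ht0
  have hint := h.intervalIntegrable_energyForm_moll hN hs0 hs2 n x (mem_Ioi.1 ht0)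
  have hch := sq_posPart_sub_eq_integral hint (mol n w₀ x) c
  have e : ∀ r : ℝ, 0 ≤ r → ∀ f : ℝ → ℝ, ∫ q in (0:ℝ)..r, f q = ∫ q in Ioo 0 r, f q := by
    intro r hr f
    rw [intervalIntegral.integral_of_le hr, integral_Ioc_eq_integral_Ioo]
  rw [e t (mem_Ioi.1 ht0).le, ← ht, e t (mem_Ioi.1 ht0).le] at hch
  rw [hch, ← integral_const_mul, ← integral_neg]
  -- At almost every r < t the weak identity turns the absolutely continuous function of the chain
  -- rule back into `mol n (w r) x`. The factor 2 from the square cancels the 1/2 of the weak form.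
  refine integral_congr_ae ?_
  filter_upwards [ae_restrict_mem measurableSet_Ioo,
    ae_restrict_of_ae_restrict_of_subset Ioo_subset_Ioi_self hw] with r hr hr2
  rw [e r hr.1.le, ← hr2]
  ring

theorem measurable_mol (h : IsRegularSolution s C κ w₀ w) (n : ℕ) :
    Measurable fun q : ℝ × Eucl N => mol n (w q.1) q.2 :=
  measurable_mol_uncurry h.measurable n

/-- The exceptional null set of times in `ae_sq_posPart_mol` depends on x. Fubini exchanges the two
quantifiers, at the price of joint measurability of the set where the identity holds. -/
theorem ae_ae_sq_posPart_mol (h : IsRegularSolution s C κ w₀ w) (hN : 1 ≤ N)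
    (hs0 : 0 < s) (hs2 : s < 2) (c : ℝ) (n : ℕ) :
    ∀ᵐ t ∂(volume.restrict (Ioi (0 : ℝ))), ∀ᵐ x,
      max (mol n (w t) x - c) 0 ^ 2 - max (mol n w₀ x - c) 0 ^ 2
        = -∫ r in Ioo 0 t, max (mol n (w r) x - c) 0
            * energyForm s (κ r) (w r) (fun y => moll N n (x - y)) := by
  rw [Measure.ae_ae_comm]
  · exact Eventually.of_forall (h.ae_sq_posPart_mol hN hs0 hs2 c n)
  have hm := h.measurable_mol n
  have hm0 : Measurable fun q : ℝ × Eucl N => mol n w₀ q.2 :=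
    (_root_.measurable_mol h.measurable_init n).comp measurable_snd
  refine measurableSet_eq_fun ((((hm.sub_const c).max measurable_const).pow_const 2).sub
    (((hm0.sub_const c).max measurable_const).pow_const 2)) (Measurable.neg ?_)
  have hF : Measurable fun q : ℝ × Eucl N => max (mol n (w q.1) q.2 - c) 0
      * energyForm s (κ q.1) (w q.1) (fun y => moll N n (q.2 - y)) :=
    ((hm.sub_const c).max measurable_const).mul (h.measurable_energyForm_moll n)
  -- The domain of integration depends on t; as an indicator on the product space it leaves a
  -- parametric integral over a fixed domain.
  have hS : MeasurableSet {q : (ℝ × Eucl N) × ℝ | 0 < q.2 ∧ q.2 < q.1.1} :=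
    (measurableSet_lt measurable_const measurable_snd).inter
      (measurableSet_lt measurable_snd measurable_fst.fst)
  have hG : Measurable ({q : (ℝ × Eucl N) × ℝ | 0 < q.2 ∧ q.2 < q.1.1}.indicator fun q =>
      max (mol n (w q.2) q.1.2 - c) 0
      * energyForm s (κ q.2) (w q.2) (fun y => moll N n (q.1.2 - y))) :=
    (hF.comp (measurable_snd.prodMk measurable_fst.snd)).indicator hS
  have := (hG.stronglyMeasurable.integral_prod_right' (ν := volume)).measurable
  convert this using 2 with q
  rw [← integral_indicator measurableSet_Ioo]
  refine integral_congr_ae (Eventually.of_forall fun r => ?_)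
  by_cases hr : r ∈ Ioo 0 q.1
  · rw [indicator_of_mem hr]
    symm
    refine indicator_of_mem ?_ _
    exact hr
  · rw [indicator_of_notMem hr]
    symm
    refine indicator_of_notMem ?_ _
    exact hr

end IsRegularSolution

end EnergyIdentity

/-! ### The energy identity for truncations, by removing the mollification. -/

section EnergyIdentityLimit

open Filter Topology Measure

variable {N : ℕ} {s C : ℝ} {κ : ℝ → Eucl N × Eucl N → ℝ} {w₀ : Eucl N → ℝ} {w : ℝ → Eucl N → ℝ}

namespace IsRegularSolution

theorem integrable_posPart_mul_energyForm_moll (h : IsRegularSolution s C κ w₀ w) (hN : 1 ≤ N)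
    (hs0 : 0 < s) (hs2 : s < 2) {c : ℝ} (hc : 0 ≤ c) (n : ℕ) {T : ℝ} (hT : 0 < T) :
    Integrable (Function.uncurry fun (x : Eucl N) (r : ℝ) => max (mol n (w r) x - c) 0
      * energyForm s (κ r) (w r) (fun y => moll N n (x - y)))
      (volume.prod (volume.restrict (Ioo 0 T))) := by
  obtain ⟨B, hB, hBb⟩ := exists_bound_lintegral_energyForm_moll hN hs0 hs2 C n
  have hφ := isContraction_posPart hc
  have hF : Measurable fun q : ℝ × Eucl N => max (mol n (w q.1) q.2 - c) 0
      * energyForm s (κ q.1) (w q.1) (fun y => moll N n (q.2 - y)) :=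
    (((h.measurable_mol n).sub_const c).max measurable_const).mul (h.measurable_energyForm_moll n)
  have hF' : Measurable (Function.uncurry fun (x : Eucl N) (r : ℝ) => max (mol n (w r) x - c) 0
      * energyForm s (κ r) (w r) (fun y => moll N n (x - y))) := hF.comp measurable_swap
  refine ⟨hF'.aestronglyMeasurable, ?_⟩
  rw [HasFiniteIntegral]
  refine (lintegral_prod_symm' _ hF'.enorm).trans_lt ?_
  refine lt_of_le_of_lt (lintegral_mono (g := fun r => B * sobolevSq s (w r)) fun r => ?_) ?_
  · have hv : Measurable fun x => max (mol n (w r) x - c) 0 :=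
      hφ.measurable_comp (_root_.measurable_mol (h.measurable_slice r) n)
    refine le_trans (lintegral_mono fun x => ?_) ((hBb (κ r) (w r) _ (h.kernel_nonneg r)
      (h.kernel_le r) (h.measurable_slice r) hv).trans (mul_le_mul_right (add_le_add
        (pow_le_pow_left' ?_ 2) le_rfl) _))
    · simp only [Function.uncurry, energyForm]
      rw [← integral_const_mul]
      exact enorm_integral_le_lintegral_enorm _
    · exact hφ.eLpNorm_comp_le.trans (eLpNorm_mol_le (h.measurable_slice r) n)
  · rw [lintegral_const_mul' _ _ hB]
    exact ENNReal.mul_lt_top hB.lt_top (h.energy T hT)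

/-- The energy identity for the mollified solution. -/
theorem ae_integral_sq_posPart_mol (h : IsRegularSolution s C κ w₀ w) (hN : 1 ≤ N)
    (hs0 : 0 < s) (hs2 : s < 2) {c : ℝ} (hc : 0 ≤ c) (n : ℕ) :
    ∀ᵐ t ∂(volume.restrict (Ioi (0 : ℝ))),
      ∫ x, max (mol n (w t) x - c) 0 ^ 2 = (∫ x, max (mol n w₀ x - c) 0 ^ 2)
        - ∫ r in Ioo 0 t, energyForm s (κ r) (w r)
          (mol n ((fun a => max (a - c) 0) ∘ mol n (w r))) := by
  have hφ := isContraction_posPart hc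
  filter_upwards [h.ae_ae_sq_posPart_mol hN hs0 hs2 c n, ae_restrict_mem measurableSet_Ioi]
    with t ht ht0
  have hi : ∀ u : Eucl N → ℝ, Measurable u → MemLp u 2 volume →
      Integrable fun x => max (mol n u x - c) 0 ^ 2 := fun u hu hu2 =>
    (hφ.memLp_comp (memLp_mol hu hu2 n)).integrable_sq
  have h1 := integral_congr_ae (μ := (volume : Measure (Eucl N))) ht
  rw [integral_sub (hi _ (h.measurable_slice t) (h.memLp t)) (hi _ h.measurable_init h.memLp_init),
    integral_neg,
    integral_integral_swap (h.integrable_posPart_mul_energyForm_moll hN hs0 hs2 hc n ht0)] at h1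
  rw [sub_eq_iff_eq_add, neg_add_eq_sub] at h1
  rw [h1]
  congr 1
  refine integral_congr_ae (Eventually.of_forall fun r => ?_)
  have hm := _root_.measurable_mol (h.measurable_slice r) n
  exact integral_mul_energyForm_moll hN hs0 hs2 (h.measurable_kernel_slice r) (h.kernel_nonneg r)
    (h.kernel_le r) (h.measurable_slice r) (h.memLp_diff r) (hφ.measurable_comp hm)
    (hφ.memLp_comp (memLp_mol (h.measurable_slice r) (h.memLp r) n)) n

theorem measurable_energyForm_comp (h : IsRegularSolution s C κ w₀ w) {φ : ℝ → ℝ}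
    (hφ : IsContraction φ) : Measurable fun r => energyForm s (κ r) (w r) (φ ∘ w r) :=
  measurable_energyForm (v := fun r => φ ∘ w r) h.measurable_kernel h.measurable
    (hφ.continuous.measurable.comp h.measurable)

theorem lintegral_bound_lt_top (h : IsRegularSolution s C κ w₀ w) {T : ℝ} (hT : 0 < T) :
    ∫⁻ r in Ioo 0 T, ENNReal.ofReal C * sobolevSq s (w r) < ⊤ := by
  rw [lintegral_const_mul' _ _ ENNReal.ofReal_ne_top]
  exact ENNReal.mul_lt_top ENNReal.ofReal_lt_top (h.energy T hT)

theorem sobolevSq_lt_top (h : IsRegularSolution s C κ w₀ w) (t : ℝ) : sobolevSq s (w t) < ⊤ :=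
  ENNReal.add_lt_top.2 ⟨ENNReal.pow_lt_top (h.memLp t).2, ENNReal.pow_lt_top (h.memLp_diff t).2⟩

theorem integrableOn_energyForm_comp (h : IsRegularSolution s C κ w₀ w) {φ : ℝ → ℝ}
    (hφ : IsContraction φ) {T : ℝ} (hT : 0 < T) :
    IntegrableOn (fun r => energyForm s (κ r) (w r) (φ ∘ w r)) (Ioo 0 T) := by
  refine ⟨(h.measurable_energyForm_comp hφ).aestronglyMeasurable,
    lt_of_le_of_lt (lintegral_mono fun r => ?_) (h.lintegral_bound_lt_top hT)⟩
  refine (enorm_energyForm_le (h.kernel_nonneg r) (h.kernel_le r) (h.memLp_diff r)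
    (hφ.memLp_diff_comp (h.measurable_slice r) (h.memLp_diff r))).trans (mul_le_mul_right ?_ _)
  refine (mul_le_mul_right hφ.eLpNorm_diff_comp_le _).trans ?_
  rw [← sq]
  exact le_add_self

theorem tendsto_integral_energyForm_mol (h : IsRegularSolution s C κ w₀ w) {φ : ℝ → ℝ}
    (hφ : IsContraction φ) {T : ℝ} (hT : 0 < T) :
    Tendsto (fun n => ∫ r in Ioo 0 T, energyForm s (κ r) (w r) (mol n (φ ∘ mol n (w r)))) atTop
      (𝓝 (∫ r in Ioo 0 T, energyForm s (κ r) (w r) (φ ∘ w r))) := by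
  have hfin : ∀ r, ENNReal.ofReal C * sobolevSq s (w r) < ⊤ := fun r =>
    ENNReal.mul_lt_top ENNReal.ofReal_lt_top (h.sobolevSq_lt_top r)
  refine tendsto_integral_of_dominated_convergence
    (fun r => (ENNReal.ofReal C * sobolevSq s (w r)).toReal) (fun n => ?_) ?_ (fun n => ?_) ?_
  · refine (measurable_energyForm (v := fun r => mol n (φ ∘ mol n (w r))) h.measurable_kernel
      h.measurable ?_).aestronglyMeasurable
    exact measurable_mol_uncurry (w := fun r => φ ∘ mol n (w r))
      (hφ.continuous.measurable.comp (h.measurable_mol n)) n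
  · exact integrable_toReal_of_lintegral_ne_top (h.measurable_sobolevSq.const_mul _).aemeasurable
      (h.lintegral_bound_lt_top hT).ne
  · refine Eventually.of_forall fun r => ?_
    rw [← toReal_enorm]
    refine ENNReal.toReal_mono (hfin r).ne ?_
    exact (enorm_energyForm_mol_le (h.kernel_nonneg r) (h.kernel_le r) (h.measurable_slice r)
      (h.memLp r) (h.memLp_diff r) hφ n).trans (mul_le_mul_right le_add_self _)
  · exact Eventually.of_forall fun r => tendsto_energyForm_mol (h.measurable_kernel_slice r)
      (h.kernel_nonneg r) (h.kernel_le r) (h.measurable_slice r) (h.memLp r) (h.memLp_diff r) hφ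

/-- The energy identity for the truncated solution `(w - c)₊`. -/
theorem ae_integral_sq_posPart (h : IsRegularSolution s C κ w₀ w) (hN : 1 ≤ N)
    (hs0 : 0 < s) (hs2 : s < 2) {c : ℝ} (hc : 0 ≤ c) :
    ∀ᵐ t ∂(volume.restrict (Ioi (0 : ℝ))),
      ∫ x, max (w t x - c) 0 ^ 2 = (∫ x, max (w₀ x - c) 0 ^ 2)
        - ∫ r in Ioo 0 t, energyForm s (κ r) (w r) ((fun a => max (a - c) 0) ∘ w r) := by
  have hφ := isContraction_posPart hc
  filter_upwards [ae_all_iff.2 fun n => h.ae_integral_sq_posPart_mol hN hs0 hs2 hc n,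
    ae_restrict_mem measurableSet_Ioi] with t ht ht0
  refine tendsto_nhds_unique (hφ.tendsto_integral_sq_mol (h.measurable_slice t) (h.memLp t)) ?_
  refine Tendsto.congr (fun n => (ht n).symm) ?_
  exact (hφ.tendsto_integral_sq_mol h.measurable_init h.memLp_init).sub
    (h.tendsto_integral_energyForm_mol hφ ht0)

end IsRegularSolution

end EnergyIdentityLimit

/-! ### A Nash inequality at scale ρ and the comparison of two levels. -/

section Nash

open Filter Topology Measure

variable {N : ℕ} {s C l : ℝ} {k : Eucl N × Eucl N → ℝ} {u v : Eucl N → ℝ}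

/-- The volume of the unit ball. -/
noncomputable def unitBallVolume (N : ℕ) : ℝ := (volume (Metric.closedBall (0 : Eucl N) 1)).toReal

theorem unitBallVolume_pos (N : ℕ) : 0 < unitBallVolume N :=
  ENNReal.toReal_pos (Metric.measure_closedBall_pos volume _ one_pos).ne'
    measure_closedBall_lt_top.ne

theorem volume_closedBall_eq {ρ : ℝ} (hρ : 0 < ρ) :
    volume (Metric.closedBall (0 : Eucl N) ρ) = ENNReal.ofReal (ρ ^ N * unitBallVolume N) := by
  rw [Measure.addHaar_closedBall' _ _ hρ.le, finrank_euclideanSpace_fin,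
    ENNReal.ofReal_mul (by positivity), unitBallVolume,
    ENNReal.ofReal_toReal measure_closedBall_lt_top.ne]

theorem lintegral_nearIndicator_mul {f : Eucl N → ℝ≥0∞} (hf : Measurable f) (ρ : ℝ) :
    ∫⁻ p : Eucl N × Eucl N, nearIndicator ρ p * f p.2
      = volume (Metric.closedBall (0 : Eucl N) ρ) * ∫⁻ y, f y := by
  have hm : Measurable fun p : Eucl N × Eucl N => nearIndicator ρ p * f p.2 :=
    (measurable_nearIndicator ρ).mul (hf.comp measurable_snd)
  rw [Measure.volume_eq_prod, lintegral_prod_symm' _ hm, ← lintegral_const_mul _ hf]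
  refine lintegral_congr fun y => ?_
  have h1 : Measurable fun x : Eucl N => nearIndicator ρ (x, y) :=
    (measurable_nearIndicator ρ).comp measurable_prodMk_right
  dsimp only
  rw [lintegral_mul_const _ h1, lintegral_nearIndicator]

theorem nearIndicator_of_le {ρ : ℝ} {p : Eucl N × Eucl N} (h : dist p.1 p.2 ≤ ρ) :
    nearIndicator ρ p = 1 := indicator_of_mem (by exact h) _

theorem nearIndicator_of_lt {ρ : ℝ} {p : Eucl N × Eucl N} (h : ρ < dist p.1 p.2) :
    nearIndicator ρ p = 0 := indicator_of_notMem (by exact not_le.2 h) _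

/-- A local Nash inequality. -/
theorem nash_inequality (hs0 : 0 < s) (hv : Measurable v) (hv0 : ∀ x, 0 ≤ v x) {ρ : ℝ}
    (hρ : 0 < ρ) :
    volume (Metric.closedBall (0 : Eucl N) ρ) * ∫⁻ x, ENNReal.ofReal (v x ^ 2)
      ≤ ENNReal.ofReal (ρ ^ ((N : ℝ) + s))
          * ∫⁻ p, nearIndicator ρ p * ENNReal.ofReal (diff v p ^ 2) ∂gagliardoMeasure N s
        + 2 * (∫⁻ x, ENNReal.ofReal (v x)) ^ 2 := by
  have hd := measurable_diff hv
  have hχ := measurable_nearIndicator (N := N) ρ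
  have hd2 : Measurable fun p => nearIndicator ρ p * ENNReal.ofReal (diff v p ^ 2) :=
    hχ.mul (hd.pow_const 2).ennreal_ofReal
  have hprod : Measurable fun p : Eucl N × Eucl N =>
      ENNReal.ofReal (v p.1) * ENNReal.ofReal (v p.2) :=
    (hv.comp measurable_fst).ennreal_ofReal.mul (hv.comp measurable_snd).ennreal_ofReal
  rw [← lintegral_nearIndicator_mul (hv.pow_const 2).ennreal_ofReal]
  -- Pointwise b² ≤ (a - b)² + 2ab for a = v(x), b = v(y). The product term is kept on the whole
  -- space, where it integrates to the squared L¹ norm.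
  calc _ ≤ ∫⁻ p : Eucl N × Eucl N, (nearIndicator ρ p * ENNReal.ofReal (diff v p ^ 2)
        + 2 * (ENNReal.ofReal (v p.1) * ENNReal.ofReal (v p.2))) := by
        refine lintegral_mono fun p => ?_
        rcases le_or_gt (dist p.1 p.2) ρ with h | h
        · rw [nearIndicator_of_le h, one_mul, one_mul, ← ENNReal.ofReal_mul (hv0 _),
            show (2 : ℝ≥0∞) = ENNReal.ofReal 2 by simp, ← ENNReal.ofReal_mul (by norm_num),
            ← ENNReal.ofReal_add (sq_nonneg _)
              (mul_nonneg (by norm_num) (mul_nonneg (hv0 _) (hv0 _)))]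
          refine ENNReal.ofReal_le_ofReal ?_
          simp only [diff]
          nlinarith [sq_nonneg (v p.1)]
        · rw [nearIndicator_of_lt h]
          simp
    _ = (∫⁻ p, nearIndicator ρ p * ENNReal.ofReal (diff v p ^ 2))
        + 2 * (∫⁻ x, ENNReal.ofReal (v x)) ^ 2 := by
        rw [lintegral_add_left hd2, lintegral_const_mul _ hprod, Measure.volume_eq_prod,
          lintegral_prod_mul hv.ennreal_ofReal.aemeasurable hv.ennreal_ofReal.aemeasurable, sq]
    _ ≤ _ := by
        refine add_le_add ?_ le_rfl
        rw [gagliardoMeasure, lintegral_withDensity_eq_lintegral_mul_non_measurable _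
          (measurable_gagliardoDensity N s).ennreal_ofReal (by simp),
          ← lintegral_const_mul' _ _ ENNReal.ofReal_ne_top]
        refine lintegral_mono fun p => ?_
        simp only [Pi.mul_apply]
        -- Within distance ρ the weight ρ^(N+s) |x - y|^(-(N+s)) is at least 1; on the diagonal the
        -- difference is zero.
        rcases le_or_gt (dist p.1 p.2) ρ with h | h
        · rw [nearIndicator_of_le h, one_mul, ← ENNReal.ofReal_mul (by positivity),
            ← ENNReal.ofReal_mul (by positivity)]
          refine ENNReal.ofReal_le_ofReal ?_
          rcases eq_or_ne p.1 p.2 with he | he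
          · simp [diff, he]
          · rw [dist_eq_norm] at h
            have hpos : 0 < ‖p.1 - p.2‖ := norm_pos_iff.2 (sub_ne_zero.2 he)
            rw [← mul_assoc]
            refine le_mul_of_one_le_left (sq_nonneg _) ?_
            rw [Real.rpow_neg hpos.le, ← div_eq_mul_inv, one_le_div (by positivity)]
            exact Real.rpow_le_rpow hpos.le h (by positivity)
        · rw [nearIndicator_of_lt h]
          simp

/-- Coercivity of the form on truncations. -/
theorem lintegral_diff_posPart_le (hk : Measurable k) (hk0 : ∀ p, 0 ≤ k p) (hkC : ∀ p, k p ≤ C)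
    (hl : 0 < l) {ρ : ℝ} (hkl : ∀ p : Eucl N × Eucl N, ‖p.1 - p.2‖ ≤ ρ → l ≤ k p)
    (hu : Measurable u) (hd : MemLp (diff u) 2 (gagliardoMeasure N s)) {c : ℝ} (hc : 0 ≤ c) :
    ∫⁻ p, nearIndicator ρ p * ENNReal.ofReal (diff ((fun a => max (a - c) 0) ∘ u) p ^ 2)
        ∂gagliardoMeasure N s
      ≤ ENNReal.ofReal (energyForm s k u ((fun a => max (a - c) 0) ∘ u) / l) := by
  have hφ := isContraction_posPart hc
  have hpt : ∀ p, diff ((fun a => max (a - c) 0) ∘ u) p ^ 2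
      ≤ diff u p * diff ((fun a => max (a - c) 0) ∘ u) p := fun p => by
    simp only [diff, Function.comp]
    rcases max_cases (u p.1 - c) 0 with ⟨h1, h2⟩ | ⟨h1, h2⟩ <;>
      rcases max_cases (u p.2 - c) 0 with ⟨h3, h4⟩ | ⟨h3, h4⟩ <;> rw [h1, h3] <;> nlinarith
  have hpt0 : ∀ p, 0 ≤ diff u p * diff ((fun a => max (a - c) 0) ∘ u) p := fun p =>
    (sq_nonneg _).trans (hpt p)
  have hint := integrable_energy hk hk0 hkC hd (hφ.memLp_diff_comp hu hd)
  rw [energyForm, ← integral_div, ofReal_integral_eq_lintegral_ofReal (hint.div_const l)]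
  · refine lintegral_mono fun p => ?_
    rcases le_or_gt (dist p.1 p.2) ρ with h | h
    · rw [nearIndicator_of_le h, one_mul]
      refine ENNReal.ofReal_le_ofReal ((hpt p).trans ?_)
      rw [le_div_iff₀ hl, mul_comm, mul_assoc]
      rw [dist_eq_norm] at h
      exact mul_le_mul_of_nonneg_right (hkl p h) (hpt0 p)
    · rw [nearIndicator_of_lt h]
      simp
  · refine Eventually.of_forall fun p => div_nonneg ?_ hl.le
    rw [mul_assoc]
    exact mul_nonneg (hk0 p) (hpt0 p)

theorem energyForm_posPart_nonneg (hk0 : ∀ p, 0 ≤ k p) (c : ℝ) :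
    0 ≤ energyForm s k u ((fun a => max (a - c) 0) ∘ u) := by
  refine integral_nonneg fun p => ?_
  rw [Pi.zero_apply, mul_assoc]
  refine mul_nonneg (hk0 p) ?_
  simp only [diff, Function.comp]
  rcases max_cases (u p.1 - c) 0 with ⟨h1, h2⟩ | ⟨h1, h2⟩ <;>
    rcases max_cases (u p.2 - c) 0 with ⟨h3, h4⟩ | ⟨h3, h4⟩ <;> rw [h1, h3] <;>
    nlinarith [sq_nonneg (u p.1 - u p.2)]

/-- The energy above the level `c`. -/
noncomputable def levelEnergy (u : Eucl N → ℝ) (c : ℝ) : ℝ := ∫ x, max (u x - c) 0 ^ 2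

theorem levelEnergy_nonneg (u : Eucl N → ℝ) (c : ℝ) : 0 ≤ levelEnergy u c :=
  integral_nonneg fun _ => sq_nonneg _

theorem integrable_sq_posPart (hu2 : MemLp u 2 volume) {c : ℝ} (hc : 0 ≤ c) :
    Integrable fun x => max (u x - c) 0 ^ 2 :=
  ((isContraction_posPart hc).memLp_comp hu2).integrable_sq

theorem ofReal_levelEnergy (hu2 : MemLp u 2 volume) {c : ℝ} (hc : 0 ≤ c) :
    ENNReal.ofReal (levelEnergy u c) = ∫⁻ x, ENNReal.ofReal (max (u x - c) 0 ^ 2) :=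
  ofReal_integral_eq_lintegral_ofReal (integrable_sq_posPart hu2 hc)
    (Eventually.of_forall fun _ => sq_nonneg _)

theorem levelEnergy_anti (hu2 : MemLp u 2 volume) {c c' : ℝ} (hc : 0 ≤ c) (hcc : c ≤ c') :
    levelEnergy u c' ≤ levelEnergy u c := by
  refine integral_mono (integrable_sq_posPart hu2 (hc.trans hcc)) (integrable_sq_posPart hu2 hc)
    fun x => ?_
  exact pow_le_pow_left₀ (le_max_right _ _) (max_le_max (by linarith) le_rfl) 2

/-- The basic inequality between two levels. -/
theorem levelEnergy_le (hs0 : 0 < s) (hk : Measurable k) (hk0 : ∀ p, 0 ≤ k p)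
    (hkC : ∀ p, k p ≤ C) (hl : 0 < l)
    (hkl : ∀ p : Eucl N × Eucl N, ‖p.1 - p.2‖ ≤ 3 → l ≤ k p) (hu : Measurable u)
    (hu2 : MemLp u 2 volume) (hd : MemLp (diff u) 2 (gagliardoMeasure N s)) {c c' : ℝ}
    (hc' : 0 ≤ c') (hcc : c' < c) {ρ : ℝ} (hρ : 0 < ρ) (hρ3 : ρ ≤ 3) :
    levelEnergy u c ≤ 1 / (l * unitBallVolume N) * ρ ^ s
        * energyForm s k u ((fun a => max (a - c) 0) ∘ u)
      + 2 / unitBallVolume N * (ρ ^ N)⁻¹ * (levelEnergy u c' / (c - c')) ^ 2 := by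
  have hc : 0 ≤ c := hc'.trans hcc.le
  have hV := unitBallVolume_pos N
  have hφ := isContraction_posPart hc
  have hE := energyForm_posPart_nonneg (s := s) (u := u) hk0 c
  set E := energyForm s k u ((fun a => max (a - c) 0) ∘ u) with hEdef
  have hδ : 0 < c - c' := sub_pos.2 hcc
  -- Chebyshev's inequality: where u > c, the number u - c' exceeds both u - c and c - c', hence (u
  -- - c)(c - c') ≤ (u - c')².
  have h1 : ∫⁻ x, ENNReal.ofReal (max (u x - c) 0)
      ≤ ENNReal.ofReal (levelEnergy u c' / (c - c')) := by
    rw [div_eq_inv_mul, ENNReal.ofReal_mul (by positivity), ofReal_levelEnergy hu2 hc',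
      ← lintegral_const_mul' _ _ ENNReal.ofReal_ne_top]
    refine lintegral_mono fun x => ?_
    rw [← ENNReal.ofReal_mul (by positivity)]
    refine ENNReal.ofReal_le_ofReal ?_
    rw [← div_eq_inv_mul, le_div_iff₀ hδ]
    rcases max_cases (u x - c) 0 with ⟨h1, h2⟩ | ⟨h1, h2⟩
    · rw [h1, max_eq_left (by linarith)]
      nlinarith
    · rw [h1, zero_mul]
      positivity
  have h2 := nash_inequality (s := s) hs0 (hφ.measurable_comp hu) (fun x => le_max_right _ _) hρ
  have h3 := lintegral_diff_posPart_le (s := s) hk hk0 hkC hl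
    (fun p hp => hkl p (hp.trans hρ3)) hu hd hc
  have h4 : ENNReal.ofReal (ρ ^ N * unitBallVolume N) * ENNReal.ofReal (levelEnergy u c)
      ≤ ENNReal.ofReal (ρ ^ ((N : ℝ) + s)) * ENNReal.ofReal (E / l)
        + 2 * (ENNReal.ofReal (levelEnergy u c' / (c - c'))) ^ 2 := by
    rw [← volume_closedBall_eq hρ, ofReal_levelEnergy hu2 hc]
    refine h2.trans (add_le_add (mul_le_mul_right h3 _) (mul_le_mul_right ?_ _))
    exact pow_le_pow_left' h1 2
  have hA' := levelEnergy_nonneg u c'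
  rw [← ENNReal.ofReal_mul (by positivity), ← ENNReal.ofReal_mul (by positivity),
    ← ENNReal.ofReal_pow (by positivity), show (2 : ℝ≥0∞) = ENNReal.ofReal 2 by simp,
    ← ENNReal.ofReal_mul (by positivity), ← ENNReal.ofReal_add (by positivity) (by positivity),
    ENNReal.ofReal_le_ofReal_iff (by positivity), Real.rpow_add hρ, Real.rpow_natCast] at h4
  have hρN : 0 < ρ ^ N := by positivity
  rw [← mul_le_mul_iff_right₀ (mul_pos hρN hV)]
  refine h4.trans (le_of_eq ?_)
  field_simp

end Nash

/-! ### Monotonicity of level energies and one De Giorgi step. -/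

section DeGiorgi

open Filter Topology Measure

variable {N : ℕ} {s C l : ℝ} {κ : ℝ → Eucl N × Eucl N → ℝ} {w₀ : Eucl N → ℝ} {w : ℝ → Eucl N → ℝ}

namespace IsRegularSolution

/-- The dissipation above the level `c` at time `r`. -/
noncomputable def dissipation (s : ℝ) (κ : ℝ → Eucl N × Eucl N → ℝ) (w : ℝ → Eucl N → ℝ)
    (c r : ℝ) : ℝ := energyForm s (κ r) (w r) ((fun a => max (a - c) 0) ∘ w r)

/-- The energy identity at level `c` holds at time `t`. -/
def EnergyIdentityAt (s : ℝ) (κ : ℝ → Eucl N × Eucl N → ℝ) (w₀ : Eucl N → ℝ) (w : ℝ → Eucl N → ℝ)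
    (c t : ℝ) : Prop :=
  levelEnergy (w t) c = levelEnergy w₀ c - ∫ r in Ioo 0 t, dissipation s κ w c r

theorem ae_energyIdentityAt (h : IsRegularSolution s C κ w₀ w) (hN : 1 ≤ N)
    (hs0 : 0 < s) (hs2 : s < 2) {c : ℝ} (hc : 0 ≤ c) :
    ∀ᵐ t ∂(volume.restrict (Ioi (0 : ℝ))), EnergyIdentityAt s κ w₀ w c t :=
  h.ae_integral_sq_posPart hN hs0 hs2 hc

theorem dissipation_nonneg (h : IsRegularSolution s C κ w₀ w) (c r : ℝ) :
    0 ≤ dissipation s κ w c r := energyForm_posPart_nonneg (h.kernel_nonneg r) c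

theorem integrableOn_dissipation (h : IsRegularSolution s C κ w₀ w) {c : ℝ} (hc : 0 ≤ c) {T : ℝ}
    (hT : 0 < T) : IntegrableOn (dissipation s κ w c) (Ioo 0 T) :=
  h.integrableOn_energyForm_comp (isContraction_posPart hc) hT

theorem integral_dissipation_le (h : IsRegularSolution s C κ w₀ w) {c t₁ t₂ : ℝ} (hc : 0 ≤ c)
    (ht₁ : 0 < t₁) (ht : t₁ < t₂) (h₁ : EnergyIdentityAt s κ w₀ w c t₁)
    (h₂ : EnergyIdentityAt s κ w₀ w c t₂) :
    ∫ r in Ioo t₁ t₂, dissipation s κ w c r ≤ levelEnergy (w t₁) c - levelEnergy (w t₂) c := by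
  have hi := h.integrableOn_dissipation hc (ht₁.trans ht)
  have hsub : Ioo 0 t₁ ∪ Ioo t₁ t₂ ⊆ Ioo 0 t₂ :=
    union_subset (Ioo_subset_Ioo_right ht.le) (Ioo_subset_Ioo_left ht₁.le)
  have hdisj : Disjoint (Ioo 0 t₁) (Ioo t₁ t₂) :=
    Set.disjoint_left.2 fun x hx hx' => absurd (hx.2.trans hx'.1) (lt_irrefl x)
  have h3 : ∫ r in Ioo 0 t₁ ∪ Ioo t₁ t₂, dissipation s κ w c r
      ≤ ∫ r in Ioo 0 t₂, dissipation s κ w c r :=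
    setIntegral_mono_set hi (Eventually.of_forall (h.dissipation_nonneg c)) hsub.eventuallyLE
  rw [setIntegral_union hdisj measurableSet_Ioo (hi.mono_set (subset_union_left.trans hsub))
    (hi.mono_set (subset_union_right.trans hsub))] at h3
  rw [h₁, h₂]
  linarith

theorem levelEnergy_antitone (h : IsRegularSolution s C κ w₀ w) {c t₁ t₂ : ℝ} (hc : 0 ≤ c)
    (ht₁ : 0 < t₁) (ht : t₁ < t₂) (h₁ : EnergyIdentityAt s κ w₀ w c t₁)
    (h₂ : EnergyIdentityAt s κ w₀ w c t₂) : levelEnergy (w t₂) c ≤ levelEnergy (w t₁) c := by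
  have h3 := h.integral_dissipation_le hc ht₁ ht h₁ h₂
  have h4 : 0 ≤ ∫ r in Ioo t₁ t₂, dissipation s κ w c r :=
    integral_nonneg fun r => h.dissipation_nonneg c r
  linarith

theorem levelEnergy_le_init (h : IsRegularSolution s C κ w₀ w) {c t : ℝ}
    (h₁ : EnergyIdentityAt s κ w₀ w c t) : levelEnergy (w t) c ≤ levelEnergy w₀ c := by
  have h4 : 0 ≤ ∫ r in Ioo 0 t, dissipation s κ w c r :=
    integral_nonneg fun r => h.dissipation_nonneg c r
  rw [h₁]
  linarith

/-- One step of De Giorgi's iteration. -/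
theorem levelEnergy_step (h : IsRegularSolution s C κ w₀ w) (hN : 1 ≤ N) (hs0 : 0 < s)
    (hs2 : s < 2) (hl : 0 < l) (hκl : ∀ t p, ‖p.1 - p.2‖ ≤ 3 → l ≤ κ t p) {c c' : ℝ}
    (hc' : 0 ≤ c') (hcc : c' < c) {ρ : ℝ} (hρ : 0 < ρ) (hρ3 : ρ ≤ 3) {t₁ t₂ : ℝ}
    (ht₁ : 0 < t₁) (ht : t₁ < t₂) (h₁ : EnergyIdentityAt s κ w₀ w c t₁)
    (h₂ : EnergyIdentityAt s κ w₀ w c t₂) (h₁' : EnergyIdentityAt s κ w₀ w c' t₁) :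
    (t₂ - t₁) * levelEnergy (w t₂) c
      ≤ 1 / (l * unitBallVolume N) * ρ ^ s * levelEnergy (w t₁) c'
        + (t₂ - t₁) * (2 / unitBallVolume N * (ρ ^ N)⁻¹ * (levelEnergy (w t₁) c' / (c - c')) ^ 2)
      := by
  have hc : 0 ≤ c := hc'.trans hcc.le
  have hδ : 0 < c - c' := sub_pos.2 hcc
  have hV := unitBallVolume_pos N
  set a := 1 / (l * unitBallVolume N) * ρ ^ s with ha
  set b := 2 / unitBallVolume N * (ρ ^ N)⁻¹ with hb
  have ha0 : 0 ≤ a := by positivity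
  have hb0 : 0 ≤ b := by positivity
  set D := b * (levelEnergy (w t₁) c' / (c - c')) ^ 2 with hD
  have hsub : Ioo t₁ t₂ ⊆ Ioi (0 : ℝ) := fun x hx => ht₁.trans hx.1
  have hi : IntegrableOn (dissipation s κ w c) (Ioo t₁ t₂) :=
    (h.integrableOn_dissipation hc (ht₁.trans ht)).mono_set (Ioo_subset_Ioo_left ht₁.le)
  -- Monotonicity is used twice: level c is carried back from t₂ to r, and level c' from r to t₁.
  -- Only the dissipation still depends on r, and its integral is controlled by the energy drop.
  have hpt : ∀ᵐ r ∂(volume.restrict (Ioo t₁ t₂)),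
      levelEnergy (w t₂) c ≤ a * dissipation s κ w c r + D := by
    filter_upwards [ae_restrict_mem measurableSet_Ioo,
      ae_restrict_of_ae_restrict_of_subset hsub (h.ae_energyIdentityAt hN hs0 hs2 hc),
      ae_restrict_of_ae_restrict_of_subset hsub (h.ae_energyIdentityAt hN hs0 hs2 hc')]
      with r hr hgood hgood'
    refine (h.levelEnergy_antitone hc (ht₁.trans hr.1) hr.2 hgood h₂).trans ?_
    refine (levelEnergy_le hs0 (h.measurable_kernel_slice r) (h.kernel_nonneg r) (h.kernel_le r) hl
      (hκl r) (h.measurable_slice r) (h.memLp r) (h.memLp_diff r) hc' hcc hρ hρ3).trans ?_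
    have h5 := h.levelEnergy_antitone hc' ht₁ hr.1 h₁' hgood'
    have h6 := levelEnergy_nonneg (w r) c'
    have h7 : (levelEnergy (w r) c' / (c - c')) ^ 2 ≤ (levelEnergy (w t₁) c' / (c - c')) ^ 2 := by
      gcongr
    exact add_le_add le_rfl (mul_le_mul_of_nonneg_left h7 hb0)
  have hfin : volume (Ioo t₁ t₂) ≠ ⊤ := by simp
  have h3 := setIntegral_mono_ae_restrict (integrableOn_const hfin)
    ((hi.const_mul a).add (integrableOn_const hfin (C := D))) hpt
  simp only [Pi.add_apply] at h3
  rw [integral_add (hi.const_mul a) (integrableOn_const hfin), integral_const_mul,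
    setIntegral_const, setIntegral_const, Real.volume_real_Ioo_of_le ht.le, smul_eq_mul,
    smul_eq_mul] at h3
  refine h3.trans (add_le_add (mul_le_mul_of_nonneg_left ?_ ha0) le_rfl)
  have h4 := h.integral_dissipation_le hc ht₁ ht h₁ h₂
  have h5 := levelEnergy_nonneg (w t₂) c
  have h6 := levelEnergy_anti (h.memLp t₁) hc' hcc.le
  linarith

end IsRegularSolution

end DeGiorgi

/-! ### The geometric iteration and the one-sided bound. -/

section Iteration

open Filter Topology Measure

variable {N : ℕ} {s C l : ℝ} {κ : ℝ → Eucl N × Eucl N → ℝ} {w₀ : Eucl N → ℝ} {w : ℝ → Eucl N → ℝ}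

/-- The energy identities hold only at almost every time, so the times of the iteration are picked
inside open windows. -/
theorem exists_mem_Ioo_of_ae {P : ℝ → Prop} (hP : ∀ᵐ t ∂(volume.restrict (Ioi (0 : ℝ))), P t)
    {a b : ℝ} (ha : 0 ≤ a) (hab : a < b) : ∃ t ∈ Ioo a b, P t := by
  have h1 : ∀ᵐ t ∂(volume.restrict (Ioo a b)), P t :=
    ae_restrict_of_ae_restrict_of_subset (fun x hx => lt_of_le_of_lt ha hx.1) hP
  have : NeBot (ae (volume.restrict (Ioo a b))) := by
    rw [ae_neBot, Ne, Measure.restrict_eq_zero]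
    simp [hab]
  obtain ⟨t, ht, ht'⟩ := (h1.and (ae_restrict_mem measurableSet_Ioo)).exists
  exact ⟨t, ht', ht⟩

theorem ae_le_of_levelEnergy_eq_zero {u : Eucl N → ℝ} (hu2 : MemLp u 2 volume) {M : ℝ}
    (hM : 0 ≤ M) (h : levelEnergy u M = 0) : ∀ᵐ x, u x ≤ M := by
  rw [levelEnergy, integral_eq_zero_iff_of_nonneg (fun _ => sq_nonneg _)
    (integrable_sq_posPart hu2 hM)] at h
  filter_upwards [h] with x hx
  have h1 : max (u x - M) 0 = 0 := by simpa using hx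
  linarith [le_max_left (u x - M) 0]

/-- The arithmetic of one step of the iteration. -/
theorem iteration_arith {a b q θ t₀ S M τ A A' e ν ρs ρN : ℝ} (ha : 0 < a) (hb : 0 < b)
    (hq : 0 < q) (ht₀ : 0 < t₀) (hM : 0 < M) (he : 0 < e) (hA : 0 ≤ A)
    (hθ : 0 < θ) (haθ : 8 * a * θ ≤ q) {Q : ℝ} (hQ : 0 < Q) (hQM : 8 * b * Q * S ≤ q * M ^ 2)
    (hτ : t₀ * e / 4 ≤ τ) (hν : 0 < ν) (hρs : ρs = e * t₀ * θ) (hρN : ρN * e ^ 2 = Q⁻¹ * ν)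
    (hρN0 : 0 < ρN) (hAS : A ≤ ν * S)
    (hstep : τ * A' ≤ a * ρs * A + τ * (b * ρN⁻¹ * (A / (M * e / 2)) ^ 2)) :
    A' ≤ q * ν * S := by
  have hτ0 : 0 < τ := lt_of_lt_of_le (by positivity) hτ
  have hS : 0 ≤ S := by
    by_contra! hcon
    nlinarith
  -- The dissipation term and the quadratic term may each use half of the target `q * ν * S`.
  have h1 : a * ρs * A ≤ τ * (q / 2 * (ν * S)) := by
    have : a * ρs ≤ τ * (q / 2) := by
      rw [hρs]
      calc a * (e * t₀ * θ) = (t₀ * e / 4) * (8 * a * θ / 2) := by ring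
        _ ≤ τ * (q / 2) := mul_le_mul hτ (by linarith) (by positivity) hτ0.le
    calc a * ρs * A ≤ τ * (q / 2) * (ν * S) := mul_le_mul this hAS hA (by positivity)
      _ = _ := by ring
  have h2 : b * ρN⁻¹ * (A / (M * e / 2)) ^ 2 ≤ q / 2 * (ν * S) := by
    have e1 : b * ρN⁻¹ * (A / (M * e / 2)) ^ 2 = 4 * b * A ^ 2 / (M ^ 2 * (ρN * e ^ 2)) := by
      field_simp
      ring
    rw [e1, hρN, div_le_iff₀ (by positivity)]
    have h3 : A ^ 2 ≤ (ν * S) ^ 2 := pow_le_pow_left₀ hA hAS 2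
    have h4 : 4 * b * A ^ 2 ≤ 4 * b * (ν * S) ^ 2 := by gcongr
    refine h4.trans ?_
    have h5 : (8 * b * Q * S) * (ν ^ 2 * S * Q⁻¹ / 2) ≤ (q * M ^ 2) * (ν ^ 2 * S * Q⁻¹ / 2) :=
      mul_le_mul_of_nonneg_right hQM (by positivity)
    calc 4 * b * (ν * S) ^ 2 = (8 * b * Q * S) * (ν ^ 2 * S * Q⁻¹ / 2) := by
          field_simp
          ring
      _ ≤ _ := h5
      _ = _ := by ring
  have h6 : τ * A' ≤ τ * (q * ν * S) := by
    calc τ * A' ≤ τ * (q / 2 * (ν * S)) + τ * (q / 2 * (ν * S)) :=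
          hstep.trans (add_le_add h1 (mul_le_mul_of_nonneg_left h2 hτ0.le))
      _ = _ := by ring
  exact le_of_mul_le_mul_left h6 hτ0

/-- One-sided smoothing from `L²` to `L^∞`. -/
theorem IsRegularSolution.exists_ae_le (hN : 1 ≤ N) (hs0 : 0 < s) (hs2 : s < 2) (hl : 0 < l) :
    ∃ Q : ℝ, 0 < Q ∧ ∀ (C : ℝ) (κ : ℝ → Eucl N × Eucl N → ℝ) (w₀ : Eucl N → ℝ)
      (w : ℝ → Eucl N → ℝ), IsRegularSolution s C κ w₀ w →
      (∀ t p, ‖p.1 - p.2‖ ≤ 3 → l ≤ κ t p) → ∀ S, levelEnergy w₀ 0 ≤ S →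
      ∀ t₀ : ℝ, 0 < t₀ → t₀ < 2 → ∀ M : ℝ, 0 < M → Q * t₀ ^ (-((N : ℝ) / s)) * S ≤ M ^ 2 →
      ∀ᵐ t ∂(volume.restrict (Ioi t₀)), ∀ᵐ x, w t x ≤ M := by
  have hV := unitBallVolume_pos N
  set a := 1 / (l * unitBallVolume N) with ha
  set b := 2 / unitBallVolume N with hb
  have ha0 : 0 < a := by positivity
  have hb0 : 0 < b := by positivity
  -- With e = 2^(-k) and ρ^s = e t₀ θ, the denominator ρ^N (c - c')² of the quadratic term scales
  -- like e^(N/s + 2). This ratio makes it exactly q^k, so that q^(2k) / q^k reproduces the decay.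
  set q : ℝ := 2 ^ (-((N : ℝ) / s + 2)) with hq
  have hq0 : 0 < q := by positivity
  have hq1 : q < 1 := Real.rpow_lt_one_of_one_lt_of_neg one_lt_two
    (by have : 0 ≤ (N : ℝ) / s := by positivity
        linarith)
  -- The bound 1/2, with t₀ < 2, keeps ρ ≤ 1 ≤ 3; the other bound makes the dissipation term at most
  -- half of the target.
  set θ := min (1 / 2) (q / (8 * a)) with hθ
  have hθ0 : 0 < θ := lt_min (by norm_num) (by positivity)
  refine ⟨8 * b * θ ^ (-((N : ℝ) / s)) / q, by positivity, ?_⟩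
  intro C κ w₀ w h hκl S hS t₀ ht₀ ht₀2 M hM hQM
  set c : ℕ → ℝ := fun k => M * (1 - (1 / 2) ^ k) with hc
  have hc0 : ∀ k, 0 ≤ c k := fun k =>
    mul_nonneg hM.le (sub_nonneg.2 (pow_le_one₀ (by norm_num) (by norm_num)))
  have hgood : ∀ᵐ t ∂(volume.restrict (Ioi (0 : ℝ))),
      ∀ k, IsRegularSolution.EnergyIdentityAt s κ w₀ w (c k) t :=
    ae_all_iff.2 fun k => h.ae_energyIdentityAt hN hs0 hs2 (hc0 k)
  have hex : ∀ k : ℕ, ∃ t ∈ Ioo (t₀ * (1 - (1 / 2) ^ k))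
      (t₀ * (1 - (1 / 2) ^ k) + t₀ * (1 / 2) ^ k / 4),
      ∀ j, IsRegularSolution.EnergyIdentityAt s κ w₀ w (c j) t := fun k =>
    exists_mem_Ioo_of_ae hgood
      (mul_nonneg ht₀.le (sub_nonneg.2 (pow_le_one₀ (by norm_num) (by norm_num))))
      (lt_add_of_pos_right _ (by positivity))
  choose t ht htg using hex
  have htpos : ∀ k, 0 < t k := fun k => lt_of_le_of_lt
    (mul_nonneg ht₀.le (sub_nonneg.2 (pow_le_one₀ (by norm_num) (by norm_num)))) (ht k).1
  have hdecay : ∀ k, levelEnergy (w (t k)) (c k) ≤ q ^ k * S := by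
    intro k
    induction k with
    | zero =>
      have hc00 : c 0 = 0 := by simp [hc]
      rw [pow_zero, one_mul, hc00]
      exact (h.levelEnergy_le_init (hc00 ▸ htg 0 0)).trans hS
    | succ k ih =>
      set e : ℝ := (1 / 2) ^ k with he
      have he0 : 0 < e := by positivity
      have he1 : e ≤ 1 := pow_le_one₀ (by norm_num) (by norm_num)
      have hsucc : ((1 : ℝ) / 2) ^ (k + 1) = e / 2 := by rw [pow_succ, he]; ring
      have hcc : c (k + 1) - c k = M * e / 2 := by
        simp only [hc, hsucc, ← he]; ring
      have ht1 := (ht k).2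
      have ht2 := (ht (k + 1)).1
      rw [hsucc] at ht2
      rw [← he] at ht1
      -- The k-th window covers the first quarter of the remaining time t₀ e, and the next window
      -- opens at its half, so a quarter separates them.
      have hτ : t₀ * e / 4 ≤ t (k + 1) - t k := by nlinarith
      have htt : t k < t (k + 1) := by
        have : 0 < t₀ * e / 4 := by positivity
        linarith
      have hr0 : 0 < e * t₀ * θ := by positivity
      have hr1 : e * t₀ * θ ≤ 1 := by
        have h1 : θ ≤ 1 / 2 := min_le_left _ _
        have h2 : e * t₀ ≤ 2 := by nlinarith
        nlinarith [mul_le_mul h2 h1 hθ0.le (by norm_num)]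
      have hρ3 : (e * t₀ * θ) ^ (1 / s) ≤ 3 :=
        (Real.rpow_le_one hr0.le hr1 (by positivity)).trans (by norm_num)
      have hstep := h.levelEnergy_step hN hs0 hs2 hl hκl (hc0 k)
        (by have : 0 < M * e / 2 := by positivity
            linarith : c k < c (k + 1))
        (Real.rpow_pos_of_pos hr0 (1 / s)) hρ3 (htpos k) htt (htg k (k + 1)) (htg (k + 1) (k + 1))
        (htg k k)
      rw [hcc] at hstep
      rw [pow_succ' q k]
      refine iteration_arith (θ := θ) (t₀ := t₀) (e := e) (Q := (t₀ * θ) ^ (-((N : ℝ) / s)))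
        (ρN := ((e * t₀ * θ) ^ (1 / s)) ^ N) (ρs := ((e * t₀ * θ) ^ (1 / s)) ^ s)
        ha0 hb0 hq0 ht₀ hM he0 (levelEnergy_nonneg _ _) hθ0 ?_ (by positivity) ?_ hτ
        (pow_pos hq0 k) ?_ ?_ (by positivity) ih hstep
      · have : θ ≤ q / (8 * a) := min_le_right _ _
        rw [le_div_iff₀ (by positivity)] at this
        linarith
      · rw [Real.mul_rpow ht₀.le hθ0.le]
        have : 8 * b * θ ^ (-((N : ℝ) / s)) / q * t₀ ^ (-((N : ℝ) / s)) * S * q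
            ≤ M ^ 2 * q := mul_le_mul_of_nonneg_right hQM hq0.le
        calc _ = 8 * b * θ ^ (-((N : ℝ) / s)) / q * t₀ ^ (-((N : ℝ) / s)) * S * q := by
              field_simp
          _ ≤ M ^ 2 * q := this
          _ = _ := by ring
      · rw [← Real.rpow_mul hr0.le, one_div_mul_cancel hs0.ne', Real.rpow_one]
      · have e1 : ((e * t₀ * θ) ^ (1 / s)) ^ N = e ^ ((N : ℝ) / s) * (t₀ * θ) ^ ((N : ℝ) / s) := by
          rw [← Real.rpow_natCast, ← Real.rpow_mul hr0.le, mul_assoc,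
            Real.mul_rpow he0.le (by positivity)]
          congr 2 <;> ring
        have e2 : q ^ k = e ^ ((N : ℝ) / s) * e ^ 2 := by
          rw [← Real.rpow_natCast e 2, ← Real.rpow_add he0, he, hq, ← Real.rpow_natCast,
            ← Real.rpow_natCast, ← Real.rpow_mul (by norm_num), ← Real.rpow_mul (by norm_num),
            one_div, Real.inv_rpow (by norm_num), ← Real.rpow_neg (by norm_num)]
          congr 1
          push_cast
          ring
        rw [e1, e2, Real.rpow_neg (by positivity), inv_inv]
        ring
  have hfinal : ∀ᵐ r ∂(volume.restrict (Ioi t₀)),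
      ∀ k, IsRegularSolution.EnergyIdentityAt s κ w₀ w (c k) r :=
    ae_restrict_of_ae_restrict_of_subset (Ioi_subset_Ioi ht₀.le) hgood
  filter_upwards [hfinal, ae_restrict_mem measurableSet_Ioi] with r hr hrt
  -- Every iteration time precedes r and every level is below M, so the energy of `w r` above M is
  -- at most q^k S for all k.
  refine ae_le_of_levelEnergy_eq_zero (h.memLp r) hM.le
    (le_antisymm (ge_of_tendsto' (x := atTop) (f := fun k : ℕ => q ^ k * S) ?_ fun k => ?_)
      (levelEnergy_nonneg _ _))
  · have := (tendsto_pow_atTop_nhds_zero_of_lt_one hq0.le hq1).mul_const S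
    rwa [zero_mul] at this
  · have he0 : (0 : ℝ) < (1 / 2) ^ k := by positivity
    have hck : c k ≤ M := by
      simp only [hc]
      nlinarith
    have htk : t k < r := by
      have h1 := (ht k).2
      have h2 : t₀ < r := hrt
      have h3 : 0 < t₀ * (1 / 2) ^ k := by positivity
      nlinarith
    exact (levelEnergy_anti (h.memLp r) (hc0 k) hck).trans
      ((h.levelEnergy_antitone (hc0 k) (htpos k) htk (htg k k) (hr k)).trans (hdecay k))

end Iteration

/-! ### Regular representatives of weak solutions, the sign symmetry, and constants. -/

section Reduction

open Filter Topology Measure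

variable {N : ℕ} {s C Λ : ℝ}

theorem enorm_sq_eq_ofReal (a : ℝ) : ‖a‖ₑ ^ 2 = ENNReal.ofReal (a ^ 2) := by
  rw [Real.enorm_eq_ofReal_abs, ← ENNReal.ofReal_pow (abs_nonneg _), sq_abs]

theorem sobolevSq_eq (u : Eucl N → ℝ) :
    sobolevSq s u = (∫⁻ x, ENNReal.ofReal (u x ^ 2)) + gagliardoSq s u := by
  rw [sobolevSq, eLpNorm_two_sq, eLpNorm_two_sq]
  simp only [enorm_sq_eq_ofReal]
  congr 1
  rw [gagliardoMeasure, lintegral_withDensity_eq_lintegral_mul_non_measurable _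
    (measurable_gagliardoDensity N s).ennreal_ofReal (by simp), gagliardoSq]
  refine lintegral_congr fun p => ?_
  simp only [Pi.mul_apply]
  rw [← ENNReal.ofReal_mul (by positivity), Real.rpow_neg (norm_nonneg _), ← div_eq_inv_mul]
  rfl

theorem diff_ae_eq {u u' : Eucl N → ℝ} (h : u =ᵐ[volume] u') :
    diff u =ᵐ[(volume : Measure (Eucl N × Eucl N))] diff u' := by
  filter_upwards [Measure.quasiMeasurePreserving_fst.ae h,
    Measure.quasiMeasurePreserving_snd.ae h] with p h1 h2
  simp only [diff, h1, h2]

theorem sobolevSq_congr {u u' : Eucl N → ℝ} (h : u =ᵐ[volume] u') :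
    sobolevSq s u = sobolevSq s u' := by
  rw [sobolevSq, sobolevSq, eLpNorm_congr_ae h,
    eLpNorm_congr_ae (gagliardoMeasure_absolutelyContinuous.ae_le (diff_ae_eq h))]

theorem mol_congr {u u' : Eucl N → ℝ} (h : u =ᵐ[volume] u') (n : ℕ) (x : Eucl N) :
    mol n u x = mol n u' x := by
  rw [mol_eq, mol_eq]
  refine integral_congr_ae ?_
  filter_upwards [h] with y hy
  rw [hy]

/-- The measurable normalized kernel `κ(t,x,y) = K(t,x,y) |x - y|^{N+s}`, truncated so that the
ellipticity bounds hold everywhere. -/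
noncomputable def normalizedKernel (s l C : ℝ) (K : ℝ × Eucl N × Eucl N → ℝ) (t : ℝ)
    (p : Eucl N × Eucl N) : ℝ :=
  max ({z : Eucl N | ‖z‖ ≤ 3}.indicator (fun _ => l) (p.1 - p.2))
    (min C (K (t, p) * ‖p.1 - p.2‖ ^ ((N : ℝ) + s)))

theorem measurable_normalizedKernel {K : ℝ × Eucl N × Eucl N → ℝ} (hK : Measurable K) (l : ℝ) :
    Measurable (Function.uncurry (normalizedKernel s l C K)) := by
  have h1 : Measurable ({z : Eucl N | ‖z‖ ≤ 3}.indicator fun _ => l) :=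
    measurable_const.indicator (measurableSet_le measurable_norm measurable_const)
  have h2 : Measurable fun q : ℝ × Eucl N × Eucl N => q.2.1 - q.2.2 := by fun_prop
  have h3 : Measurable fun q : ℝ × Eucl N × Eucl N => ‖q.2.1 - q.2.2‖ ^ ((N : ℝ) + s) := by
    fun_prop
  exact (h1.comp h2).max (measurable_const.min (hK.mul h3))

/-- Off the diagonal the ellipticity bounds make both truncations inactive; on the diagonal, where K
is unconstrained, the differences vanish. -/
theorem energyForm_eq_kernelForm {K : ℝ → Eucl N → Eucl N → ℝ} (hK : IsAdmissibleKernel N s Λ K)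
    {K' : ℝ × Eucl N × Eucl N → ℝ} {t : ℝ} (ht : 0 < t)
    (hKK : ∀ᵐ p : Eucl N × Eucl N, K t p.1 p.2 = K' (t, p)) {u u' : Eucl N → ℝ}
    (hu : u =ᵐ[volume] u') (η : Eucl N → ℝ) :
    energyForm s (normalizedKernel s ((1 - s / 2) / Λ) ((1 - s / 2) * Λ) K' t) u' η
      = kernelForm (K t) u η := by
  rw [energyForm, gagliardoMeasure, integral_withDensity_eq_integral_toReal_smul
    (measurable_gagliardoDensity N s).ennreal_ofReal (by simp), kernelForm]
  refine integral_congr_ae ?_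
  filter_upwards [hKK, diff_ae_eq hu] with p hp hd
  have hd' : u p.1 - u p.2 = diff u' p := hd
  rw [ENNReal.toReal_ofReal (by positivity), hd', smul_eq_mul]
  rcases eq_or_ne p.1 p.2 with he | he
  · have : diff u' p = 0 := by simp [diff, he]
    simp [this]
  · have hpos : 0 < ‖p.1 - p.2‖ := norm_pos_iff.2 (sub_ne_zero.2 he)
    have hJ : 0 < ‖p.1 - p.2‖ ^ ((N : ℝ) + s) := Real.rpow_pos_of_pos hpos _
    have hup := hK.upper t ht _ _ he
    have hlo := hK.lower t ht _ _ he
    rw [Real.rpow_neg hpos.le, ← div_eq_mul_inv] at hup hlo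
    rw [le_div_iff₀ hJ] at hup
    rw [div_le_iff₀ hJ] at hlo
    have hind : {z : Eucl N | ‖z‖ ≤ 3}.indicator (fun _ => (1 - s / 2) / Λ) (p.1 - p.2)
        = {z : Eucl N | ‖z‖ ≤ 3}.indicator (fun _ => (1 : ℝ)) (p.1 - p.2) * ((1 - s / 2) / Λ) := by
      simp only [indicator_apply]
      split_ifs <;> simp
    rw [normalizedKernel, ← hp, hind, min_eq_right hup, max_eq_right hlo,
      Real.rpow_neg hpos.le, diff, diff]
    field_simp

theorem contDiff_moll_sub (n : ℕ) (x : Eucl N) : ContDiff ℝ ∞ fun y => moll N n (x - y) :=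
  (contDiff_moll n).comp (contDiff_const.sub contDiff_id)

theorem hasCompactSupport_moll_sub (n : ℕ) (x : Eucl N) :
    HasCompactSupport fun y => moll N n (x - y) :=
  (hasCompactSupport_moll n).comp_homeomorph (Homeomorph.subLeft x)

theorem ae_restrict_Ioi_of_Ioo {P : ℝ → Prop}
    (h : ∀ T > 0, ∀ᵐ t ∂(volume.restrict (Ioo (0 : ℝ) T)), P t) :
    ∀ᵐ t ∂(volume.restrict (Ioi (0 : ℝ))), P t := by
  have hU : Ioi (0 : ℝ) = ⋃ n : ℕ, Ioo (0 : ℝ) (n + 1) := by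
    ext t
    simp only [mem_Ioi, mem_iUnion, mem_Ioo]
    refine ⟨fun ht => ?_, fun ⟨n, hn⟩ => hn.1⟩
    obtain ⟨n, hn⟩ := exists_nat_gt t
    exact ⟨n, ht, hn.trans (lt_add_one _)⟩
  rw [hU, ae_restrict_iUnion_iff]
  exact fun n => h _ (by positivity)

/-- Every weak solution has a regular representative. -/
theorem IsWeakSolution.exists_isRegularSolution (hs2 : s < 2) (hΛ : 0 < Λ)
    {K : ℝ → Eucl N → Eucl N → ℝ} (hK : IsAdmissibleKernel N s Λ K) {w₀ : Eucl N → ℝ}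
    (hw₀ : MemLp w₀ 2 volume) {w : ℝ → Eucl N → ℝ} (hw : IsWeakSolution s K w₀ w) :
    ∃ (C : ℝ) (κ : ℝ → Eucl N × Eucl N → ℝ) (w₀' : Eucl N → ℝ) (w' : ℝ → Eucl N → ℝ),
      IsRegularSolution s C κ w₀' w' ∧ (∀ t p, ‖p.1 - p.2‖ ≤ 3 → (1 - s / 2) / Λ ≤ κ t p)
        ∧ w₀ =ᵐ[volume] w₀' ∧ ∀ᵐ t ∂(volume.restrict (Ioi (0 : ℝ))), w t =ᵐ[volume] w' t := by
  have hl : 0 < (1 - s / 2) / Λ := div_pos (by linarith) hΛ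
  have hprod : ∀ {β : Type} [MeasureSpace β] [SFinite (volume : Measure β)],
      (volume : Measure (ℝ × β)).restrict (Ioi (0 : ℝ) ×ˢ univ)
        = (volume.restrict (Ioi (0 : ℝ))).prod (volume : Measure β) := by
    intro β _ _
    rw [Measure.volume_eq_prod, ← Measure.prod_restrict, Measure.restrict_univ]
  obtain ⟨K', hK'm, hKK'⟩ := hK.aemeasurable
  obtain ⟨w₁, hw₁m, hww₁⟩ := hw.aemeasurable
  obtain ⟨w₀', hw₀'m, hw₀'⟩ := hw₀.1.aemeasurable
  rw [Filter.EventuallyEq, hprod] at hKK' hww₁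
  have hKae := Measure.ae_ae_of_ae_prod hKK'
  have hwae := Measure.ae_ae_of_ae_prod hww₁
  set w₂ : ℝ → Eucl N → ℝ := fun t x => w₁ (t, x) with hw₂
  have hw₂m : Measurable (Function.uncurry w₂) := hw₁m
  have hw₂d : Measurable (Function.uncurry fun t => diff (w₂ t)) := by
    have h1 : Measurable fun q : ℝ × Eucl N × Eucl N => (q.1, q.2.1) := by fun_prop
    have h2 : Measurable fun q : ℝ × Eucl N × Eucl N => (q.1, q.2.2) := by fun_prop
    exact (hw₂m.comp h1).sub (hw₂m.comp h2)
  have hsobm : Measurable fun t => sobolevSq s (w₂ t) :=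
    (measurable_eLpNorm_sq hw₂m).add (measurable_eLpNorm_sq hw₂d)
  have hsub : ∀ T : ℝ, Ioo 0 T ⊆ Ioi 0 := fun T => Ioo_subset_Ioi_self
  have henergy : ∀ T > 0, ∫⁻ t in Ioo 0 T, sobolevSq s (w₂ t) < ⊤ := fun T hT => by
    refine lt_of_le_of_lt (le_of_eq (lintegral_congr_ae ?_)) (hw.energy T hT)
    filter_upwards [ae_restrict_of_ae_restrict_of_subset (hsub T) hwae] with t ht
    rw [← sobolevSq_eq]
    exact (sobolevSq_congr ht).symm
  -- Setting the solution to zero at the null set of times of infinite norm puts every slice, not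
  -- just almost every one, in H^{s/2}.
  set G : Set ℝ := {t | sobolevSq s (w₂ t) < ⊤} with hG
  have hGm : MeasurableSet G := measurableSet_lt hsobm measurable_const
  have hGae : ∀ᵐ t ∂(volume.restrict (Ioi (0 : ℝ))), t ∈ G :=
    ae_restrict_Ioi_of_Ioo fun T hT => ae_lt_top hsobm (henergy T hT).ne
  set w' : ℝ → Eucl N → ℝ := fun t => G.indicator w₂ t with hw'
  have hw'mem : ∀ t ∈ G, w' t = w₂ t := fun t ht => indicator_of_mem ht _
  have hw'not : ∀ t ∉ G, w' t = 0 := fun t ht => indicator_of_notMem ht _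
  have hw'ae : ∀ᵐ t ∂(volume.restrict (Ioi (0 : ℝ))), w t =ᵐ[volume] w' t := by
    filter_upwards [hwae, hGae] with t ht htG
    rw [hw'mem t htG]
    exact ht
  have hw'm : Measurable (Function.uncurry w') := by
    have : Function.uncurry w' = (Prod.fst ⁻¹' G).indicator (Function.uncurry w₂) := by
      funext q
      by_cases hq : q.1 ∈ G
      · rw [indicator_of_mem (by exact hq), Function.uncurry, hw'mem _ hq, Function.uncurry]
      · rw [indicator_of_notMem (by exact hq), Function.uncurry, hw'not _ hq, Pi.zero_apply]
    rw [this]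
    exact hw₂m.indicator (measurable_fst hGm)
  have hdiff0 : diff (0 : Eucl N → ℝ) = 0 := by funext p; simp [diff]
  -- Nothing assumes Λ ≥ 1, so the lower ellipticity constant may formally exceed the upper one; the
  -- maximum bounds the truncated kernel in both cases.
  refine ⟨max ((1 - s / 2) / Λ) ((1 - s / 2) * Λ),
    normalizedKernel s ((1 - s / 2) / Λ) ((1 - s / 2) * Λ) K', w₀', w', ?_, ?_, hw₀', hw'ae⟩
  · refine ⟨measurable_normalizedKernel hK'm _, fun t p => ?_, fun t p => ?_, hw₀'m,
      hw₀.ae_eq hw₀', hw'm, fun t => ?_, fun t => ?_, fun T hT => ?_, fun n x => ?_⟩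
    · exact le_max_of_le_left (indicator_nonneg (fun _ _ => hl.le) _)
    · exact max_le_max (indicator_le_self' (fun _ _ => hl.le) _) (min_le_left _ _)
    · by_cases ht : t ∈ G
      · rw [hw'mem t ht]
        have h1 : eLpNorm (w₂ t) 2 volume ^ 2 < ⊤ := lt_of_le_of_lt le_self_add ht
        exact ⟨(hw₂m.comp measurable_prodMk_left).aestronglyMeasurable,
          (ENNReal.pow_lt_top_iff.1 h1).resolve_right two_ne_zero⟩
      · rw [hw'not t ht]
        exact MemLp.zero
    · by_cases ht : t ∈ G
      · rw [hw'mem t ht]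
        have h1 : eLpNorm (diff (w₂ t)) 2 (gagliardoMeasure N s) ^ 2 < ⊤ :=
          lt_of_le_of_lt le_add_self ht
        exact ⟨(hw₂d.comp measurable_prodMk_left).aestronglyMeasurable,
          (ENNReal.pow_lt_top_iff.1 h1).resolve_right two_ne_zero⟩
      · rw [hw'not t ht, hdiff0]
        exact MemLp.zero
    · refine lt_of_le_of_lt (lintegral_mono fun t => ?_) (henergy T hT)
      by_cases ht : t ∈ G
      · rw [hw'mem t ht]
      · rw [hw'not t ht, sobolevSq, hdiff0]
        simp
    · have hweak := hw.weak _ (contDiff_moll_sub n x) (hasCompactSupport_moll_sub n x)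
      filter_upwards [hweak, hw'ae] with t ht htw
      rw [← mol_congr htw, ← mol_congr hw₀', mol_eq, mol_eq]
      have hE : ∫ r in Ioo 0 t, (1 / 2) * energyForm s
          (normalizedKernel s ((1 - s / 2) / Λ) ((1 - s / 2) * Λ) K' r) (w' r)
            (fun y => moll N n (x - y))
          = ∫ r in Ioo 0 t, (1 / 2) * kernelForm (K r) (w r) (fun y => moll N n (x - y)) := by
        refine integral_congr_ae ?_
        filter_upwards [ae_restrict_of_ae_restrict_of_subset (hsub t) hKae,
          ae_restrict_of_ae_restrict_of_subset (hsub t) hw'ae,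
          ae_restrict_mem measurableSet_Ioo] with r hr1 hr2 hr3
        rw [energyForm_eq_kernelForm hK hr3.1 hr1 hr2]
      rw [hE]
      linarith
  · intro t p hp
    refine le_max_of_le_left (le_of_eq ?_)
    rw [indicator_of_mem (by exact hp)]

theorem diff_neg (u : Eucl N → ℝ) : diff (-u) = -diff u := by
  funext p
  simp only [diff, Pi.neg_apply]
  ring

theorem mol_neg (n : ℕ) (u : Eucl N → ℝ) (x : Eucl N) : mol n (-u) x = -mol n u x := by
  simp only [mol, Pi.neg_apply, integral_neg]

theorem energyForm_neg (κ : Eucl N × Eucl N → ℝ) (u v : Eucl N → ℝ) :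
    energyForm s κ (-u) v = -energyForm s κ u v := by
  simp only [energyForm, diff_neg, Pi.neg_apply, mul_neg, neg_mul, integral_neg]

theorem IsRegularSolution.neg {κ : ℝ → Eucl N × Eucl N → ℝ} {w₀ : Eucl N → ℝ}
    {w : ℝ → Eucl N → ℝ} (h : IsRegularSolution s C κ w₀ w) :
    IsRegularSolution s C κ (-w₀) (-w) where
  measurable_kernel := h.measurable_kernel
  kernel_nonneg := h.kernel_nonneg
  kernel_le := h.kernel_le
  measurable_init := h.measurable_init.neg
  memLp_init := h.memLp_init.neg
  measurable := h.measurable.neg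
  memLp t := (h.memLp t).neg
  memLp_diff t := by
    rw [Pi.neg_apply, diff_neg]
    exact (h.memLp_diff t).neg
  energy T hT := by
    refine lt_of_le_of_lt (le_of_eq (lintegral_congr fun t => ?_)) (h.energy T hT)
    rw [Pi.neg_apply, sobolevSq, diff_neg, eLpNorm_neg, eLpNorm_neg, sobolevSq]
  weak n x := by
    filter_upwards [h.weak n x] with t ht
    simp only [Pi.neg_apply, mol_neg, energyForm_neg, mul_neg, integral_neg, ht]
    ring

theorem levelEnergy_zero_le {u : Eucl N → ℝ} (hu2 : MemLp u 2 volume) :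
    levelEnergy u 0 ≤ (eLpNorm u 2 volume).toReal ^ 2 := by
  rw [← ENNReal.toReal_pow, ← integral_sq_eq hu2.1]
  refine integral_mono (integrable_sq_posPart hu2 le_rfl) hu2.integrable_sq fun x => ?_
  rw [sub_zero]
  rcases max_cases (u x) 0 with ⟨h1, _⟩ | ⟨h1, _⟩
  · rw [h1]
  · simp only [h1]
    nlinarith [sq_nonneg (u x)]

/-- The iteration yields the power t₀^(-d) for the square of the bound. Since t₀/2 < 1, (t₀/2)^(d+1)
≤ t₀^d, and the larger power in the statement only weakens the estimate. -/
theorem smoothing_constant_le {Q d W t₀ δ : ℝ} (hd : 0 ≤ d) (hW : 0 ≤ W)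
    (ht₀ : 0 < t₀) (ht₀2 : t₀ < 2) (hδ : 0 ≤ δ) {ε₀ : ℝ} (hε : 0 < ε₀) (hεQ : 4 * ε₀ * Q ≤ 1) :
    Q * t₀ ^ (-d) * W ^ 2 ≤ (W / (2 * Real.sqrt ε₀ * (t₀ / 2) ^ ((d + 1) / 2)) + δ) ^ 2 := by
  have hB : 0 ≤ W / (2 * Real.sqrt ε₀ * (t₀ / 2) ^ ((d + 1) / 2)) := by positivity
  refine le_trans ?_ (pow_le_pow_left₀ hB (le_add_of_nonneg_right hδ) 2)
  have h2 : 0 < t₀ / 2 := by linarith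
  have e1 : (2 * Real.sqrt ε₀ * (t₀ / 2) ^ ((d + 1) / 2)) ^ 2 = 4 * ε₀ * (t₀ / 2) ^ (d + 1) := by
    rw [mul_pow, mul_pow, Real.sq_sqrt hε.le, ← Real.rpow_natCast ((t₀ / 2) ^ _),
      ← Real.rpow_mul h2.le]
    norm_num
  have e2 : (t₀ / 2) ^ (d + 1) ≤ t₀ ^ d :=
    (Real.rpow_le_rpow_of_exponent_ge h2 (by linarith) (by linarith)).trans
      (Real.rpow_le_rpow h2.le (by linarith) hd)
  have hp : 0 < t₀ ^ d := Real.rpow_pos_of_pos ht₀ d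
  have hp2 : 0 < (t₀ / 2) ^ (d + 1) := Real.rpow_pos_of_pos h2 _
  rw [div_pow, e1, le_div_iff₀ (by positivity), Real.rpow_neg ht₀.le]
  have h3 : Q * (t₀ ^ d)⁻¹ * (4 * ε₀ * (t₀ / 2) ^ (d + 1)) ≤ 1 := by
    calc _ = (4 * ε₀ * Q) * ((t₀ / 2) ^ (d + 1) * (t₀ ^ d)⁻¹) := by ring
      _ ≤ 1 * 1 := by
        refine mul_le_mul hεQ ?_ (by positivity) zero_le_one
        rw [← div_eq_mul_inv, div_le_one hp]
        exact e2
      _ = 1 := one_mul 1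
  calc _ = (Q * (t₀ ^ d)⁻¹ * (4 * ε₀ * (t₀ / 2) ^ (d + 1))) * W ^ 2 := by ring
    _ ≤ 1 * W ^ 2 := mul_le_mul_of_nonneg_right h3 (sq_nonneg W)
    _ = W ^ 2 := one_mul _

end Reduction

theorem corollary1 (N : ℕ) (hN : 1 ≤ N) (s : ℝ) (hs0 : 0 < s) (hs2 : s < 2)
    (Λ : ℝ) (hΛ : 0 < Λ) :
    ∃ ε₀ : ℝ, 0 < ε₀ ∧ ε₀ < 1 ∧
      ∀ K : ℝ → EuclideanSpace ℝ (Fin N) → EuclideanSpace ℝ (Fin N) → ℝ,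
        IsAdmissibleKernel N s Λ K →
      ∀ w₀ : EuclideanSpace ℝ (Fin N) → ℝ, MemLp w₀ 2 volume →
      ∀ w : ℝ → EuclideanSpace ℝ (Fin N) → ℝ, IsWeakSolution s K w₀ w →
      ∀ t₀ : ℝ, 0 < t₀ → t₀ < 2 →
        ∀ᵐ p : ℝ × EuclideanSpace ℝ (Fin N) ∂(volume.restrict (Ioi t₀ ×ˢ univ)),
          |w p.1 p.2| ≤
            (eLpNorm w₀ 2 volume).toReal
              / (2 * Real.sqrt ε₀ * (t₀ / 2) ^ (((N : ℝ) / s + 1) / 2)) := by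
  obtain ⟨Q, hQ, hmain⟩ := IsRegularSolution.exists_ae_le (N := N) hN hs0 hs2
    (div_pos (by linarith) hΛ : 0 < (1 - s / 2) / Λ)
  have hε0 : 0 < min (1 / 2) (1 / (4 * Q)) := lt_min (by norm_num) (by positivity)
  refine ⟨min (1 / 2) (1 / (4 * Q)), hε0, (min_le_left _ _).trans_lt (by norm_num), ?_⟩
  have hεQ : 4 * min (1 / 2) (1 / (4 * Q)) * Q ≤ 1 := by
    have := min_le_right (1 / 2) (1 / (4 * Q))
    rw [le_div_iff₀ (by positivity)] at this
    linarith
  set ε₀ := min (1 / 2) (1 / (4 * Q))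
  intro K hK w₀ hw₀ w hw t₀ ht₀ ht₀2
  obtain ⟨C, κ, w₀', w', hreg, hκl, hw₀', hww'⟩ := hw.exists_isRegularSolution hs2 hΛ hK hw₀
  have hWeq : eLpNorm w₀ 2 volume = eLpNorm w₀' 2 volume := eLpNorm_congr_ae hw₀'
  rw [hWeq]
  set W := (eLpNorm w₀' 2 volume).toReal with hW
  set B := W / (2 * Real.sqrt ε₀ * (t₀ / 2) ^ (((N : ℝ) / s + 1) / 2)) with hB
  have hB0 : 0 ≤ B := div_nonneg ENNReal.toReal_nonneg (by positivity)
  -- The one-sided bound needs M > 0, whereas B = 0 when the initial value vanishes; hence the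
  -- margin 1/(n+1), removed in the limit.
  have hM : ∀ n : ℕ, Q * t₀ ^ (-((N : ℝ) / s)) * W ^ 2 ≤ (B + 1 / ((n : ℝ) + 1)) ^ 2 := fun n =>
    smoothing_constant_le (by positivity) ENNReal.toReal_nonneg ht₀ ht₀2 (by positivity) hε0 hεQ
  have hup := ae_all_iff.2 fun n : ℕ => hmain C κ w₀' w' hreg hκl (W ^ 2)
    (levelEnergy_zero_le hreg.memLp_init) t₀ ht₀ ht₀2 _ (by positivity) (hM n)
  have hlo := ae_all_iff.2 fun n : ℕ => hmain C κ (-w₀') (-w') hreg.neg hκl (W ^ 2)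
    (by rw [hW, ← eLpNorm_neg]; exact levelEnergy_zero_le hreg.neg.memLp_init) t₀ ht₀ ht₀2 _
    (by positivity) (hM n)
  have hlim : Filter.Tendsto (fun n : ℕ => B + 1 / ((n : ℝ) + 1)) Filter.atTop (nhds B) := by
    simpa using tendsto_one_div_add_atTop_nhds_zero_nat.const_add B
  have hsubset : Ioi t₀ ⊆ Ioi (0 : ℝ) := Ioi_subset_Ioi ht₀.le
  obtain ⟨w₁, hw₁m, hww₁⟩ := hw.aemeasurable
  have hww₁' : ∀ᵐ p ∂(volume.restrict (Ioi t₀ ×ˢ (univ : Set (Eucl N)))), w p.1 p.2 = w₁ p :=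
    ae_restrict_of_ae_restrict_of_subset (prod_mono_left hsubset) hww₁
  -- Passing from almost every t and x to almost every (t, x) requires a measurable set, hence the
  -- measurable representative `w₁`.
  have hset : MeasurableSet {p : ℝ × Eucl N | |w₁ p| ≤ B} :=
    measurableSet_le hw₁m.abs measurable_const
  have hmeas : (volume : Measure (ℝ × Eucl N)).restrict (Ioi t₀ ×ˢ univ)
      = (volume.restrict (Ioi t₀)).prod volume := by
    rw [Measure.volume_eq_prod, ← Measure.prod_restrict, Measure.restrict_univ]
  have hw₁B : ∀ᵐ p ∂(volume.restrict (Ioi t₀ ×ˢ (univ : Set (Eucl N)))), |w₁ p| ≤ B := by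
    rw [hmeas] at hww₁' ⊢
    refine (Measure.ae_prod_iff_ae_ae hset).2 ?_
    filter_upwards [hup, hlo, Measure.ae_ae_of_ae_prod hww₁',
      ae_restrict_of_ae_restrict_of_subset hsubset hww'] with t h1 h2 h3 h4
    filter_upwards [ae_all_iff.2 h1, ae_all_iff.2 h2, h3, h4] with x h1 h2 h3 h4
    rw [← h3, h4]
    refine abs_le.2 ⟨?_, ge_of_tendsto' hlim h1⟩
    have := ge_of_tendsto' hlim h2
    simp only [Pi.neg_apply] at this
    linarith
  filter_upwards [hww₁', hw₁B] with p h1 h2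
  rw [h1]
  exact h2
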